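/- Let $(N,g)$ be a smooth, compact, connected Riemannian manifold without boundary, of dimension $n\ge 1$, and let $S$ be a continuous, symmetric, positive definite $(0,2)$-tensor field on $N$. Let $D$ be the diameter of $(N,g)$ and let $\lambda_{\max}(S)$ be the maximum over $N$ of the eigenvalues of $S$ with respect to $g$. Let $u\in C^2(N)$ be a real-valued solution of $$\det{}^{1/n}\Big(\nabla^2 u + du\otimes du - \frac{|\nabla u|^2}{2}\,g + S\Big) = e^{-2u}\quad\text{on } N,$$ where $\nabla^2 u$ is the Hessian of $u$ for the Levi-Civita connection of $g$, $\nabla u$ is its gradient, the determinant of a symmetric $(0,2)$-tensor is the product of its eigenvalues with respect to $g$, and the determinant on the left is required to be nonnegative so that its real $n$-th root is meaningful. If $\lambda_{\max}(S)\,D^2 < \pi^2/2$, then $$2\log\Big(\cos\big(D\sqrt{\lambda_{\max}(S)/2}\,\big)\Big) + \sup_N u < \inf_N u .$$ -/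

import Mathlib

open Bundle Manifold
open scoped ContDiff

noncomputable section

namespace ConformalHessian

variable {n : ℕ} {N : Type*} [MetricSpace N] [ChartedSpace (EuclideanSpace ℝ (Fin n)) N]

/-- The partial derivative `∂_i f` at `y` of a function on `ℝⁿ`. -/
def partialD (i : Fin n) (f : EuclideanSpace ℝ (Fin n) → ℝ) (y : EuclideanSpace ℝ (Fin n)) : ℝ :=
  fderiv ℝ f y (EuclideanSpace.single i 1)

/-- The expression `u ∘ φ⁻¹` of a function `u` in the preferred chart `φ` at `c`. -/
def inChart (c : N) (u : N → ℝ) (y : EuclideanSpace ℝ (Fin n)) : ℝ :=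
  u ((extChartAt (𝓡 n) c).symm y)

/-- The coordinate vector field `∂_i` of the preferred chart at `c`, at the point of `N` with
coordinates `y`. -/
def coordField (c : N) (i : Fin n) (y : EuclideanSpace ℝ (Fin n)) :
    TangentSpace (𝓡 n) ((extChartAt (𝓡 n) c).symm y) :=
  mfderiv 𝓘(ℝ, EuclideanSpace ℝ (Fin n)) (𝓡 n) (extChartAt (𝓡 n) c).symm y
    (EuclideanSpace.single i (1 : ℝ) : EuclideanSpace ℝ (Fin n))

/-- The coordinates `v^i = dφ^i(v)` of a tangent vector at `x`, in the preferred chart at `x`. -/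
def vecCoord (x : N) (v : TangentSpace (𝓡 n) x) : EuclideanSpace ℝ (Fin n) :=
  mfderiv (𝓡 n) 𝓘(ℝ, EuclideanSpace ℝ (Fin n)) (extChartAt (𝓡 n) x) x v

variable [RiemannianBundle (fun x : N ↦ TangentSpace (𝓡 n) x)]

/-- The matrix `g_{ij} = g(∂_i, ∂_j)` of the metric in the preferred chart at `c`. -/
def metricMatrix (c : N) (y : EuclideanSpace ℝ (Fin n)) : Matrix (Fin n) (Fin n) ℝ :=
  Matrix.of fun i j ↦ inner ℝ (coordField c i y) (coordField c j y)

/-- The Christoffel symbols of the Levi-Civita connection,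
`Γ^l_{ij} = ½ g^{lm} (∂_i g_{jm} + ∂_j g_{im} - ∂_m g_{ij})`, in the preferred chart at `c`. -/
def christoffel (c : N) (l i j : Fin n) (y : EuclideanSpace ℝ (Fin n)) : ℝ :=
  (1 / 2) * ∑ m, (metricMatrix c y)⁻¹ l m *
    (partialD i (fun z ↦ metricMatrix c z j m) y + partialD j (fun z ↦ metricMatrix c z i m) y
      - partialD m (fun z ↦ metricMatrix c z i j) y)

/-- The components `∂_i ∂_j u - Γ^l_{ij} ∂_l u` of the Hessian in the preferred chart at `c`. -/
def hessianCoeff (c : N) (u : N → ℝ) (i j : Fin n) (y : EuclideanSpace ℝ (Fin n)) : ℝ :=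
  partialD i (partialD j (inChart c u)) y
    - ∑ l : Fin n, christoffel c l i j y * partialD l (inChart c u) y

/-- The Riemannian Hessian `(∇²u)_x (v, w)`. -/
def hessian (u : N → ℝ) (x : N) (v w : TangentSpace (𝓡 n) x) : ℝ :=
  ∑ i, ∑ j, hessianCoeff x u i j (extChartAt (𝓡 n) x x) * vecCoord x v i * vecCoord x w j

/-- The Riemannian gradient of `u` at `x`: the vector with `⟪∇u, v⟫ = du(v)` for all `v`. -/
def riemGradient (u : N → ℝ) (x : N) : TangentSpace (𝓡 n) x :=
  haveI : FiniteDimensional ℝ (TangentSpace (𝓡 n) x) :=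
    inferInstanceAs (FiniteDimensional ℝ (EuclideanSpace ℝ (Fin n)))
  haveI : CompleteSpace (TangentSpace (𝓡 n) x) := FiniteDimensional.complete ℝ _
  (InnerProductSpace.toDual ℝ (TangentSpace (𝓡 n) x)).symm (mvfderiv (𝓡 n) u x)

/-- The value at `(v, w)` of the symmetric tensor `∇²u + du ⊗ du - (|∇u|² / 2) g + S` at `x`. -/
def modifiedHessian
    (S : ∀ x : N, TangentSpace (𝓡 n) x →L[ℝ] TangentSpace (𝓡 n) x →L[ℝ] ℝ) (u : N → ℝ)
    (x : N) (v w : TangentSpace (𝓡 n) x) : ℝ :=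
  hessian (n := n) u x v w + mvfderiv (𝓡 n) u x v * mvfderiv (𝓡 n) u x w
    - ‖riemGradient (n := n) u x‖ ^ 2 / 2 * inner ℝ v w + S x v w

/-- The determinant (product of the eigenvalues with respect to the metric) of a bilinear form on
`T_x N`: the determinant of its matrix in an orthonormal basis of `T_x N`. -/
def metricDet (x : N) (A : TangentSpace (𝓡 n) x → TangentSpace (𝓡 n) x → ℝ) : ℝ :=
  haveI : FiniteDimensional ℝ (TangentSpace (𝓡 n) x) :=
    inferInstanceAs (FiniteDimensional ℝ (EuclideanSpace ℝ (Fin n)))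
  Matrix.det (Matrix.of fun i j ↦
    A (stdOrthonormalBasis ℝ (TangentSpace (𝓡 n) x) i)
      (stdOrthonormalBasis ℝ (TangentSpace (𝓡 n) x) j))

/-- `u` solves `det^{1/n}(∇²u + du ⊗ du - (|∇u|² / 2) g + S) = e^{-2u}`. The condition `0 ≤ det`
makes the real `n`-th root meaningful; for negative numbers `Real.rpow` is not the root. -/
def SolvesDetEquation
    (S : ∀ x : N, TangentSpace (𝓡 n) x →L[ℝ] TangentSpace (𝓡 n) x →L[ℝ] ℝ) (u : N → ℝ) : Prop :=
  ∀ x : N, 0 ≤ metricDet x (modifiedHessian S u x) ∧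
    metricDet x (modifiedHessian S u x) ^ (1 / (n : ℝ)) = Real.exp (-2 * u x)

/-- The supremum over `N` of the eigenvalues of the symmetric tensor `S` with respect to the
metric: `μ` is an eigenvalue at `x` if `S(v, ·) = μ g(v, ·)` for some nonzero `v ∈ T_x N`. -/
def lambdaMax (S : ∀ x : N, TangentSpace (𝓡 n) x →L[ℝ] TangentSpace (𝓡 n) x →L[ℝ] ℝ) : ℝ :=
  sSup {μ : ℝ | ∃ (x : N) (v : TangentSpace (𝓡 n) x), v ≠ 0 ∧
    ∀ w : TangentSpace (𝓡 n) x, S x v w = μ * inner ℝ v w}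

end ConformalHessian

end

/-! Write W for the modified Hessian and q = |∇u|². The equation serves only to make W positive
definite: det W never vanishes, W ≥ S > 0 at a minimum of u, and positivity is both open and closed
on the connected N (`modifiedHessian_pos`). By compactness W > εg for some ε > 0, and this margin is
the source of the strict inequality.

Put K = (λ_max(S) - ε)/2 with ε ≤ λ_max(S), and maximise P = e^u (q/4 + K). If ∇u ≠ 0 at a maximum
of P, then dP(∇u) = 0 together with dq(∇u) = 2∇²u(∇u, ∇u) gives W(∇u, ∇u) = S(∇u, ∇u) - 2Kq ≤ εq, a
contradiction. So ∇u = 0 there, and comparing values of P gives q ≤ 4K(e^{max u - u} - 1) everywhere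
(`innerGrad_le_of_form_lt`).

This bound says that arccos(e^{(u - max u)/2}) has gradient at most √K wherever it is
differentiable. Integrating along nearly minimising curves from a maximum point to a minimum point
(`arccos_exp_le_mul_dist`) bounds its value at the minimum by √K·D < D√(λ_max(S)/2) < π/2; taking
the cosine and the logarithm finishes.

Since `hessian` uses a different chart at each point, its continuity and the formula for dq(∇u) rest
on chart independence, obtained from a polarisation identity for gradients
(`two_mul_hessian_gradCoeff`, `hessian_eq_sum`). -/

noncomputable section

namespace ConformalHessian

open Filter Topology
open scoped Matrix

/-! ### Gradients and the Hessian for a variable metric matrix on ℝⁿ. -/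

section Euclid

variable {n : ℕ}

local notation "𝔼" => EuclideanSpace ℝ (Fin n)

/-- The vector `G⁻¹ df` of components of the gradient of `f` for the metric with matrix `G`. -/
def gradCoeff (G : 𝔼 → Matrix (Fin n) (Fin n) ℝ) (f : 𝔼 → ℝ) (y : 𝔼) (i : Fin n) : ℝ :=
  ∑ j, (G y)⁻¹ i j * partialD j f y

/-- The inner product of the gradients of `f` and `k` for the metric with matrix `G`. -/
def gradInner (G : 𝔼 → Matrix (Fin n) (Fin n) ℝ) (f k : 𝔼 → ℝ) (y : 𝔼) : ℝ :=
  ∑ i, partialD i f y * gradCoeff G k y i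

theorem partialD_sum {ι : Type*} (s : Finset ι) (m : Fin n) {f : ι → 𝔼 → ℝ} {y : 𝔼}
    (hf : ∀ i ∈ s, DifferentiableAt ℝ (f i) y) :
    partialD m (fun z ↦ ∑ i ∈ s, f i z) y = ∑ i ∈ s, partialD m (f i) y := by
  simp only [partialD]
  rw [fderiv_fun_sum hf]
  simp

theorem partialD_mul (m : Fin n) {f g : 𝔼 → ℝ} {y : 𝔼}
    (hf : DifferentiableAt ℝ f y) (hg : DifferentiableAt ℝ g y) :
    partialD m (fun z ↦ f z * g z) y = partialD m f y * g y + f y * partialD m g y := by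
  simp only [partialD]
  rw [fderiv_fun_mul hf hg]
  simp
  ring

theorem partialD_congr (m : Fin n) {f g : 𝔼 → ℝ} {y : 𝔼} (h : f =ᶠ[𝓝 y] g) :
    partialD m f y = partialD m g y := by
  simp only [partialD, h.fderiv_eq]

theorem fderiv_apply_eq_sum (f : 𝔼 → ℝ) (y ξ : 𝔼) :
    fderiv ℝ f y ξ = ∑ i, ξ i * partialD i f y := by
  have h : ξ = ∑ i, ξ i • (EuclideanSpace.single i (1 : ℝ) : 𝔼) := by
    ext j
    simp [Pi.single_apply]
  conv_lhs => rw [h]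
  simp [partialD]

theorem contDiffAt_partialD (j : Fin n) {f : 𝔼 → ℝ} {y : 𝔼} {r : WithTop ℕ∞} {s : WithTop ℕ∞}
    (hf : ContDiffAt ℝ s f y) (h : r + 1 ≤ s) :
    ContDiffAt ℝ r (partialD j f) y :=
  (hf.fderiv_right h).clm_apply contDiffAt_const

theorem partialD_comm (i j : Fin n) {f : 𝔼 → ℝ} {y : 𝔼} (hf : ContDiffAt ℝ 2 f y) :
    partialD i (partialD j f) y = partialD j (partialD i f) y := by
  have hd : DifferentiableAt ℝ (fderiv ℝ f) y :=
    (hf.fderiv_right (m := 1) (by norm_num)).differentiableAt one_ne_zero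
  have key : ∀ a b : Fin n, partialD a (partialD b f) y
      = fderiv ℝ (fderiv ℝ f) y (EuclideanSpace.single a 1) (EuclideanSpace.single b 1) := by
    intro a b
    simp only [partialD]
    change fderiv ℝ (fun z ↦ fderiv ℝ f z (EuclideanSpace.single b 1)) y _ = _
    rw [fderiv_clm_apply hd (differentiableAt_const _)]
    simp
  rw [key, key]
  exact (hf.isSymmSndFDerivAt (by simp)) _ _

/-- Cramer's rule: each entry of the inverse is a polynomial in the entries of `G` divided by the
determinant. -/
theorem contDiffAt_inv_apply {X : Type*} [NormedAddCommGroup X] [NormedSpace ℝ X]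
    {G : X → Matrix (Fin n) (Fin n) ℝ} {y : X} {r : WithTop ℕ∞}
    (hG : ∀ i j, ContDiffAt ℝ r (fun z ↦ G z i j) y) (hdet : (G y).det ≠ 0) (i j : Fin n) :
    ContDiffAt ℝ r (fun z ↦ (G z)⁻¹ i j) y := by
  have hdetc : ∀ F : X → Matrix (Fin n) (Fin n) ℝ, (∀ i j, ContDiffAt ℝ r (fun z ↦ F z i j) y) →
      ContDiffAt ℝ r (fun z ↦ (F z).det) y := by
    intro F hF
    simp only [Matrix.det_apply']
    exact ContDiffAt.sum fun σ _ ↦ contDiffAt_const.mul (contDiffAt_prod fun i _ ↦ hF _ _)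
  simp only [Matrix.inv_def, Matrix.smul_apply, Ring.inverse_eq_inv', smul_eq_mul,
    Matrix.adjugate_apply]
  refine ((hdetc G hG).inv hdet).mul (hdetc _ fun a b ↦ ?_)
  -- An adjugate entry is the determinant of `G` with row `j` replaced by a constant vector.
  by_cases h : a = j
  · subst h
    simp only [Matrix.updateRow_self]
    exact contDiffAt_const
  · simp only [Matrix.updateRow_ne h]
    exact hG a b

theorem contDiffAt_gradCoeff {G : 𝔼 → Matrix (Fin n) (Fin n) ℝ} {y : 𝔼} {f : 𝔼 → ℝ}
    {r s : WithTop ℕ∞}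
    (hG : ∀ i j, ContDiffAt ℝ r (fun z ↦ G z i j) y) (hdet : (G y).det ≠ 0)
    (hf : ContDiffAt ℝ s f y) (h : r + 1 ≤ s) (i : Fin n) :
    ContDiffAt ℝ r (fun z ↦ gradCoeff G f z i) y :=
  ContDiffAt.sum fun j _ ↦ (contDiffAt_inv_apply hG hdet i j).mul (contDiffAt_partialD j hf h)

theorem contDiffAt_gradInner {G : 𝔼 → Matrix (Fin n) (Fin n) ℝ} {y : 𝔼} {f k : 𝔼 → ℝ}
    {r s : WithTop ℕ∞}
    (hG : ∀ i j, ContDiffAt ℝ r (fun z ↦ G z i j) y) (hdet : (G y).det ≠ 0)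
    (hf : ContDiffAt ℝ s f y) (hk : ContDiffAt ℝ s k y) (h : r + 1 ≤ s) :
    ContDiffAt ℝ r (gradInner G f k) y :=
  ContDiffAt.sum fun i _ ↦ (contDiffAt_partialD i hf h).mul (contDiffAt_gradCoeff hG hdet hk h i)

theorem sum_mul_gradCoeff {G : 𝔼 → Matrix (Fin n) (Fin n) ℝ} {y : 𝔼} (hdet : (G y).det ≠ 0)
    (f : 𝔼 → ℝ) (i : Fin n) : ∑ j, G y i j * gradCoeff G f y j = partialD i f y := by
  have h1 : G y * (G y)⁻¹ = 1 := Matrix.mul_nonsing_inv _ (isUnit_iff_ne_zero.2 hdet)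
  have h2 := congrFun (Matrix.mulVec_mulVec (fun j ↦ partialD j f y) (G y) (G y)⁻¹) i
  rw [h1, Matrix.one_mulVec] at h2
  simpa [Matrix.mulVec, dotProduct, gradCoeff] using h2

/-- The derivative of `G⁻¹` is never computed. Differentiating G·∇k = dk, which holds near `y`
because the determinant stays nonzero, trades the derivative of ∇k for those of `G` and dk; symmetry
of `G` moves it onto ∇f. -/
theorem partialD_gradInner {G : 𝔼 → Matrix (Fin n) (Fin n) ℝ} {y : 𝔼} {f k : 𝔼 → ℝ}
    (hG : ∀ i j, ContDiffAt ℝ 1 (fun z ↦ G z i j) y) (hsymm : (G y).IsSymm)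
    (hdet : (G y).det ≠ 0) (hf : ContDiffAt ℝ 2 f y) (hk : ContDiffAt ℝ 2 k y) (m : Fin n) :
    partialD m (gradInner G f k) y =
      ∑ i, partialD m (partialD i f) y * gradCoeff G k y i
      + ∑ j, gradCoeff G f y j * partialD m (partialD j k) y
      - ∑ j, ∑ i, gradCoeff G f y j * (partialD m (fun z ↦ G z j i) y * gradCoeff G k y i) := by
  have h12 : (1 : WithTop ℕ∞) + 1 ≤ 2 := by norm_num
  have hGd : ∀ i j, DifferentiableAt ℝ (fun z ↦ G z i j) y :=
    fun i j ↦ (hG i j).differentiableAt one_ne_zero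
  have hkd : ∀ i, DifferentiableAt ℝ (fun z ↦ gradCoeff G k z i) y := fun i ↦
    (contDiffAt_gradCoeff hG hdet hk h12 i).differentiableAt one_ne_zero
  have hfd : ∀ i, DifferentiableAt ℝ (partialD i f) y := fun i ↦
    (contDiffAt_partialD i hf h12).differentiableAt one_ne_zero
  have hdet' : ∀ᶠ z in 𝓝 y, (G z).det ≠ 0 := by
    have : ContinuousAt (fun z ↦ (G z).det) y := by
      simp only [Matrix.det_apply]
      refine tendsto_finsetSum _ fun σ _ ↦ ?_
      exact Tendsto.const_smul (tendsto_finsetProd _ fun i _ ↦ (hGd _ _).continuousAt) _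
    exact this.eventually_ne hdet
  have e1 : partialD m (gradInner G f k) y =
      ∑ i, (partialD m (partialD i f) y * gradCoeff G k y i
        + partialD i f y * partialD m (fun z ↦ gradCoeff G k z i) y) := by
    unfold gradInner
    rw [partialD_sum _ _ fun i _ ↦ (hfd i).fun_mul (hkd i)]
    exact Finset.sum_congr rfl fun i _ ↦ partialD_mul m (hfd i) (hkd i)
  have e2 : ∀ j, partialD m (partialD j k) y = ∑ i, (partialD m (fun z ↦ G z j i) y
      * gradCoeff G k y i + G y j i * partialD m (fun z ↦ gradCoeff G k z i) y) := by
    intro j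
    have : partialD j k =ᶠ[𝓝 y] fun z ↦ ∑ i, G z j i * gradCoeff G k z i := by
      filter_upwards [hdet'] with z hz
      rw [sum_mul_gradCoeff hz]
    rw [partialD_congr m this, partialD_sum _ _ fun i _ ↦ (hGd j i).fun_mul (hkd i)]
    exact Finset.sum_congr rfl fun i _ ↦ partialD_mul m (hGd j i) (hkd i)
  rw [e1, Finset.sum_add_distrib, add_sub_assoc]
  congr 1
  have e3 : ∑ i, partialD i f y * partialD m (fun z ↦ gradCoeff G k z i) y
      = ∑ j, ∑ i, gradCoeff G f y j * (G y j i * partialD m (fun z ↦ gradCoeff G k z i) y) := by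
    rw [Finset.sum_comm]
    refine Finset.sum_congr rfl fun i _ ↦ ?_
    rw [← sum_mul_gradCoeff hdet f i, Finset.sum_mul]
    refine Finset.sum_congr rfl fun j _ ↦ ?_
    rw [← hsymm.apply i j]
    ring
  rw [e3, ← Finset.sum_sub_distrib]
  refine Finset.sum_congr rfl fun j _ ↦ ?_
  rw [e2 j, Finset.mul_sum, ← Finset.sum_sub_distrib]
  exact Finset.sum_congr rfl fun i _ ↦ by ring

/-- `2 ∇²u(∇h, ∇k) = ⟨∇h, ∇⟨∇u, ∇k⟩⟩ + ⟨∇k, ∇⟨∇u, ∇h⟩⟩ - ⟨∇u, ∇⟨∇h, ∇k⟩⟩` in coordinates. -/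
theorem two_mul_hessian_gradCoeff {G : 𝔼 → Matrix (Fin n) (Fin n) ℝ} {y : 𝔼} {u h k : 𝔼 → ℝ}
    (hG : ∀ i j, ContDiffAt ℝ 1 (fun z ↦ G z i j) y) (hsymm : ∀ᶠ z in 𝓝 y, (G z).IsSymm)
    (hdet : (G y).det ≠ 0) (hu : ContDiffAt ℝ 2 u y) (hh : ContDiffAt ℝ 2 h y)
    (hk : ContDiffAt ℝ 2 k y) :
    2 * ∑ i, ∑ j, (partialD i (partialD j u) y - ∑ l, ((1 / 2) * ∑ m, (G y)⁻¹ l m *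
      (partialD i (fun z ↦ G z j m) y + partialD j (fun z ↦ G z i m) y
      - partialD m (fun z ↦ G z i j) y)) * partialD l u y)
        * gradCoeff G h y i * gradCoeff G k y j =
    ∑ m, gradCoeff G h y m * partialD m (gradInner G u k) y
      + ∑ m, gradCoeff G k y m * partialD m (gradInner G u h) y
      - ∑ m, gradCoeff G u y m * partialD m (gradInner G h k) y := by
  have hs : (G y).IsSymm := hsymm.self_of_nhds
  have hdsymm : ∀ m i j, partialD m (fun z ↦ G z i j) y = partialD m (fun z ↦ G z j i) y := by
    intro m i j
    refine partialD_congr m ?_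
    filter_upwards [hsymm] with z hz
    exact hz.apply j i
  have hinv : ∀ l m, (G y)⁻¹ l m = (G y)⁻¹ m l := by
    intro l m
    have : ((G y)⁻¹).IsSymm := by
      rw [Matrix.IsSymm, Matrix.transpose_nonsing_inv, hs.eq]
    exact this.apply m l
  have hchr : ∀ i j, ∑ l, ((1 / 2) * ∑ m, (G y)⁻¹ l m *
      (partialD i (fun z ↦ G z j m) y + partialD j (fun z ↦ G z i m) y
      - partialD m (fun z ↦ G z i j) y)) * partialD l u y =
      (1 / 2) * ∑ m, gradCoeff G u y m * (partialD i (fun z ↦ G z j m) y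
        + partialD j (fun z ↦ G z i m) y - partialD m (fun z ↦ G z i j) y) := by
    intro i j
    simp only [gradCoeff, Finset.sum_mul, Finset.mul_sum]
    rw [Finset.sum_comm]
    refine Finset.sum_congr rfl fun m _ ↦ Finset.sum_congr rfl fun l _ ↦ ?_
    rw [hinv l m]
    ring
  simp only [hchr, partialD_gradInner hG hs hdet hu hk, partialD_gradInner hG hs hdet hu hh,
    partialD_gradInner hG hs hdet hh hk]
  have cu := fun i j ↦ partialD_comm i j hu
  have ch := fun i j ↦ partialD_comm i j hh
  have ck := fun i j ↦ partialD_comm i j hk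
  -- From here on only finite arrays matter: second derivatives `U`, `H`, `K`, symmetric, and first
  -- derivatives `D` of the metric, symmetric in the last two indices.
  generalize gradCoeff G u y = a at *
  generalize gradCoeff G h y = b at *
  generalize gradCoeff G k y = c at *
  generalize hU : (fun i j ↦ partialD i (partialD j u) y) = U at *
  generalize hH : (fun i j ↦ partialD i (partialD j h) y) = H at *
  generalize hK : (fun i j ↦ partialD i (partialD j k) y) = K at *
  generalize hD : (fun m i j ↦ partialD m (fun z ↦ G z i j) y) = D at *
  have hU' : ∀ i j, partialD i (partialD j u) y = U i j := fun i j ↦ by rw [← hU]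
  have hH' : ∀ i j, partialD i (partialD j h) y = H i j := fun i j ↦ by rw [← hH]
  have hK' : ∀ i j, partialD i (partialD j k) y = K i j := fun i j ↦ by rw [← hK]
  have hD' : ∀ m i j, partialD m (fun z ↦ G z i j) y = D m i j := fun m i j ↦ by rw [← hD]
  simp only [hU', hH', hK', hD'] at *
  have lhs : 2 * ∑ i, ∑ j, (U i j - 1 / 2 * ∑ m, a m * (D i j m + D j i m - D m i j)) * b i * c j
      = 2 * (∑ i, ∑ j, U i j * b i * c j)
        - ((∑ i, ∑ j, ∑ m, a m * D i j m * b i * c j) + (∑ i, ∑ j, ∑ m, a m * D j i m * b i * c j)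
        - ∑ i, ∑ j, ∑ m, a m * D m i j * b i * c j) := by
    simp only [Finset.mul_sum, ← Finset.sum_add_distrib, ← Finset.sum_sub_distrib]
    refine Finset.sum_congr rfl fun i _ ↦ Finset.sum_congr rfl fun j _ ↦ ?_
    have : ∑ m, a m * D i j m * b i * c j + ∑ m, a m * D j i m * b i * c j
        - ∑ m, a m * D m i j * b i * c j
        = (∑ m, a m * (D i j m + D j i m - D m i j)) * (b i * c j) := by
      rw [Finset.sum_mul, ← Finset.sum_add_distrib, ← Finset.sum_sub_distrib]
      exact Finset.sum_congr rfl fun m _ ↦ by ring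
    simp only [Finset.sum_add_distrib, Finset.sum_sub_distrib]
    rw [this]
    simp only [← Finset.mul_sum]
    ring
  have expand : ∀ (p q r : Fin n → ℝ) (F K : Fin n → Fin n → ℝ),
      ∑ m, p m * (∑ i, F m i * q i + ∑ j, r j * K m j - ∑ j, ∑ i, r j * (D m j i * q i))
      = (∑ m, ∑ i, F m i * p m * q i) + (∑ m, ∑ i, K m i * p m * r i)
        - ∑ m, ∑ j, ∑ i, r j * D m j i * p m * q i := by
    intro p q r F K
    simp only [mul_sub, mul_add, Finset.mul_sum, Finset.sum_sub_distrib, Finset.sum_add_distrib]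
    congr 1
    · congr 1
      · exact Finset.sum_congr rfl fun _ _ ↦ Finset.sum_congr rfl fun _ _ ↦ by ring
      · exact Finset.sum_congr rfl fun _ _ ↦ Finset.sum_congr rfl fun _ _ ↦ by ring
    · exact Finset.sum_congr rfl fun _ _ ↦ Finset.sum_congr rfl fun _ _ ↦
        Finset.sum_congr rfl fun _ _ ↦ by ring
  have swap : ∀ (F : Fin n → Fin n → ℝ) (p q : Fin n → ℝ), (∀ i j, F i j = F j i) →
      ∑ i, ∑ j, F i j * p i * q j = ∑ i, ∑ j, F i j * q i * p j := by
    intro F p q hF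
    rw [Finset.sum_comm]
    exact Finset.sum_congr rfl fun i _ ↦ Finset.sum_congr rfl fun j _ ↦ by rw [hF j i]; ring
  -- The two `U` terms add up, while the `H` and `K` terms cancel; `d1`, `d2`, `d3` then match the
  -- three Christoffel terms.
  rw [lhs, expand, expand, expand, swap U c b cu, swap H a c ch, swap K a b ck]
  have d1 : ∑ i, ∑ j, ∑ m, a m * D i j m * b i * c j = ∑ m, ∑ j, ∑ i, a j * D m j i * b m * c i := by
    refine Finset.sum_congr rfl fun i _ ↦ ?_
    rw [Finset.sum_comm]
    exact Finset.sum_congr rfl fun j _ ↦ Finset.sum_congr rfl fun m _ ↦ by rw [hdsymm i j m]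
  have d2 : ∑ i, ∑ j, ∑ m, a m * D j i m * b i * c j = ∑ m, ∑ j, ∑ i, a j * D m j i * c m * b i := by
    rw [Finset.sum_comm]
    refine Finset.sum_congr rfl fun i _ ↦ ?_
    rw [Finset.sum_comm]
    exact Finset.sum_congr rfl fun j _ ↦ Finset.sum_congr rfl fun m _ ↦ by rw [hdsymm i j m]; ring
  have d3 : ∑ i, ∑ j, ∑ m, a m * D m i j * b i * c j = ∑ m, ∑ j, ∑ i, b j * D m j i * a m * c i := by
    have : ∀ i, ∑ j, ∑ m, a m * D m i j * b i * c j = ∑ m, ∑ j, a m * D m i j * b i * c j :=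
      fun i ↦ Finset.sum_comm
    simp only [this]
    rw [Finset.sum_comm]
    exact Finset.sum_congr rfl fun i _ ↦ Finset.sum_congr rfl fun j _ ↦
      Finset.sum_congr rfl fun m _ ↦ by ring
  rw [d1, d2, d3]
  ring

end Euclid

/-! ### Tangent vectors, metric and gradients in a fixed chart. -/

section Chart

variable {n : ℕ} {N : Type*} [MetricSpace N] [ChartedSpace (EuclideanSpace ℝ (Fin n)) N]

local notation "𝔼" => EuclideanSpace ℝ (Fin n)

/-- The coordinates of a tangent vector at `x` in the preferred chart at `c`. -/
def coordAt (c x : N) : TangentSpace (𝓡 n) x →L[ℝ] 𝔼 :=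
  mfderiv (𝓡 n) 𝓘(ℝ, 𝔼) (extChartAt (𝓡 n) c) x

theorem extChartAt_target_mem_nhds_of_mem {c : N} {y : 𝔼} (hy : y ∈ (extChartAt (𝓡 n) c).target) :
    (extChartAt (𝓡 n) c).target ∈ 𝓝 y :=
  (isOpen_extChartAt_target c).mem_nhds hy

theorem metricMatrix_isSymm [RiemannianBundle (fun x : N ↦ TangentSpace (𝓡 n) x)] (c : N) (y : 𝔼) :
    (metricMatrix c y).IsSymm := by
  ext i j
  exact real_inner_comm (coordField c i y) (coordField c j y)

theorem inner_riemGradient [RiemannianBundle (fun x : N ↦ TangentSpace (𝓡 n) x)] (u : N → ℝ) (x : N)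
    (v : TangentSpace (𝓡 n) x) :
    inner ℝ (riemGradient (n := n) u x) v = mvfderiv (𝓡 n) u x v := by
  have : FiniteDimensional ℝ (TangentSpace (𝓡 n) x) :=
    inferInstanceAs (FiniteDimensional ℝ 𝔼)
  have : CompleteSpace (TangentSpace (𝓡 n) x) := FiniteDimensional.complete ℝ _
  exact InnerProductSpace.toDual_symm_apply

variable [IsManifold (𝓡 n) ∞ N]

theorem contMDiffAt_extChartAt_symm {c : N} {y : 𝔼} (hy : y ∈ (extChartAt (𝓡 n) c).target) :
    ContMDiffAt 𝓘(ℝ, 𝔼) (𝓡 n) ∞ (extChartAt (𝓡 n) c).symm y :=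
  (contMDiffOn_extChartAt_symm c).contMDiffAt (extChartAt_target_mem_nhds_of_mem hy)

theorem contMDiffAt_extChartAt_of_mem {c x : N} (hx : x ∈ (extChartAt (𝓡 n) c).source) :
    ContMDiffAt (𝓡 n) 𝓘(ℝ, 𝔼) ∞ (extChartAt (𝓡 n) c) x :=
  contMDiffAt_extChartAt' (by simpa using hx)

theorem coordAt_injective {c x : N} (hx : x ∈ (extChartAt (𝓡 n) c).source) :
    Function.Injective (coordAt (n := n) c x) :=
  (isInvertible_mfderiv_extChartAt hx).bijective.1

theorem coordAt_surjective {c x : N} (hx : x ∈ (extChartAt (𝓡 n) c).source) :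
    Function.Surjective (coordAt (n := n) c x) :=
  (isInvertible_mfderiv_extChartAt hx).bijective.2

theorem coordAt_coordField {c : N} {y : 𝔼} (hy : y ∈ (extChartAt (𝓡 n) c).target) (i : Fin n) :
    coordAt c ((extChartAt (𝓡 n) c).symm y) (coordField c i y) = EuclideanSpace.single i 1 := by
  have h := mfderiv_extChartAt_comp_mfderivWithin_extChartAt_symm hy
  have hr : Set.range (𝓡 n) = Set.univ := by simp
  rw [hr, mfderivWithin_univ] at h
  exact congrArg (fun L ↦ L (EuclideanSpace.single i (1 : ℝ))) h

theorem eq_sum_coordField {c : N} {y : 𝔼} (hy : y ∈ (extChartAt (𝓡 n) c).target)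
    (v : TangentSpace (𝓡 n) ((extChartAt (𝓡 n) c).symm y)) :
    v = ∑ i, coordAt c _ v i • coordField c i y := by
  apply coordAt_injective ((extChartAt (𝓡 n) c).map_target hy)
  rw [map_sum]
  simp only [map_smul, coordAt_coordField hy]
  ext j
  simp [Pi.single_apply]

theorem mvfderiv_eq_fderiv_inChart {c x : N} (hx : x ∈ (extChartAt (𝓡 n) c).source) {u : N → ℝ}
    (hu : MDifferentiableAt (𝓡 n) 𝓘(ℝ, ℝ) u x) (v : TangentSpace (𝓡 n) x) :
    mvfderiv (𝓡 n) u x v = fderiv ℝ (inChart c u) (extChartAt (𝓡 n) c x) (coordAt c x v) := by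
  set y := extChartAt (𝓡 n) c x
  have hy : y ∈ (extChartAt (𝓡 n) c).target := (extChartAt (𝓡 n) c).map_source hx
  have hxy : (extChartAt (𝓡 n) c).symm y = x := (extChartAt (𝓡 n) c).left_inv hx
  have hin : MDifferentiableAt 𝓘(ℝ, 𝔼) 𝓘(ℝ, ℝ) (inChart c u) y := by
    refine MDifferentiableAt.comp y (g := u) (f := (extChartAt (𝓡 n) c).symm) (I' := 𝓡 n) ?_
      ((contMDiffAt_extChartAt_symm hy).mdifferentiableAt (by simp))
    rwa [hxy]
  have heq : u =ᶠ[𝓝 x] inChart c u ∘ extChartAt (𝓡 n) c := by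
    filter_upwards [(isOpen_extChartAt_source c).mem_nhds hx] with z hz
    rw [Function.comp_apply, inChart, (extChartAt (𝓡 n) c).left_inv hz]
  have h1 : mfderiv (𝓡 n) 𝓘(ℝ, ℝ) u x
      = mfderiv (𝓡 n) 𝓘(ℝ, ℝ) (inChart c u ∘ extChartAt (𝓡 n) c) x := heq.mfderiv_eq
  have h2 := mfderiv_comp (f := extChartAt (𝓡 n) c) x hin
    ((contMDiffAt_extChartAt_of_mem hx).mdifferentiableAt (by simp))
  have h3 : mvfderiv (𝓡 n) u x v = mfderiv (𝓡 n) 𝓘(ℝ, ℝ) u x v := rfl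
  rw [h3, ← mfderiv_eq_fderiv]
  exact (congrArg (fun L ↦ L v) h1).trans (congrArg (fun L ↦ L v) h2)

theorem contDiffAt_inChart {c : N} {y : 𝔼} (hy : y ∈ (extChartAt (𝓡 n) c).target) {u : N → ℝ}
    {r : WithTop ℕ∞} (hr : r ≤ ∞)
    (hu : ContMDiffAt (𝓡 n) 𝓘(ℝ, ℝ) r u ((extChartAt (𝓡 n) c).symm y)) :
    ContDiffAt ℝ r (inChart c u) y := by
  rw [← contMDiffAt_iff_contDiffAt]
  exact ContMDiffAt.comp y hu ((contMDiffAt_extChartAt_symm hy).of_le hr)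

theorem trivializationAt_snd {c x : N} (hx : x ∈ (extChartAt (𝓡 n) c).source)
    (v : TangentSpace (𝓡 n) x) :
    (trivializationAt 𝔼 (TangentSpace (𝓡 n)) c (TotalSpace.mk' 𝔼 x v)).2 = coordAt c x v := by
  have hx' : x ∈ (chartAt 𝔼 c).source := by simpa using hx
  have h := TangentBundle.continuousLinearMapAt_trivializationAt (I := 𝓡 n) hx'
  rw [coordAt, ← h, Trivialization.continuousLinearMapAt_apply, Trivialization.linearMapAt_apply]
  rw [if_pos (by simpa using hx')]

/-- In the tangent bundle trivialization at `c` the field `∂_i` is the constant basis vector. -/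
theorem contMDiffAt_coordField {c : N} {y : 𝔼} (hy : y ∈ (extChartAt (𝓡 n) c).target)
    (i : Fin n) :
    ContMDiffAt 𝓘(ℝ, 𝔼) (𝓡 n).tangent ∞ (fun z ↦ (TotalSpace.mk' 𝔼
      ((extChartAt (𝓡 n) c).symm z) (coordField c i z) : TangentBundle (𝓡 n) N)) y := by
  rw [Trivialization.contMDiffAt_iff (e := trivializationAt 𝔼 (TangentSpace (𝓡 n)) c)
    (F := 𝔼) (IB := 𝓡 n)]
  · refine ⟨contMDiffAt_extChartAt_symm hy, ?_⟩
    refine (contMDiffAt_const (c := (EuclideanSpace.single i (1 : ℝ) : 𝔼))).congr_of_eventuallyEq ?_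
    filter_upwards [extChartAt_target_mem_nhds_of_mem hy] with z hz
    rw [← coordAt_coordField hz]
    exact trivializationAt_snd ((extChartAt (𝓡 n) c).map_target hz) _
  · rw [Trivialization.mem_source]
    simpa using (extChartAt (𝓡 n) c).map_target hy

variable [RiemannianBundle (fun x : N ↦ TangentSpace (𝓡 n) x)]

theorem inner_eq_sum_metricMatrix {c x : N} (hx : x ∈ (extChartAt (𝓡 n) c).source)
    (v w : TangentSpace (𝓡 n) x) :
    inner ℝ v w = ∑ i, ∑ j, metricMatrix c (extChartAt (𝓡 n) c x) i j
      * coordAt c x v i * coordAt c x w j := by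
  obtain ⟨y, hy, rfl⟩ : ∃ y ∈ (extChartAt (𝓡 n) c).target, (extChartAt (𝓡 n) c).symm y = x :=
    ⟨_, (extChartAt (𝓡 n) c).map_source hx, (extChartAt (𝓡 n) c).left_inv hx⟩
  rw [(extChartAt (𝓡 n) c).right_inv hy]
  conv_lhs => rw [eq_sum_coordField hy v, eq_sum_coordField hy w]
  simp only [inner_sum, sum_inner, real_inner_smul_left, real_inner_smul_right, metricMatrix,
    Matrix.of_apply]
  rw [Finset.sum_comm]
  refine Finset.sum_congr rfl fun i _ ↦ Finset.sum_congr rfl fun j _ ↦ ?_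
  ring

/-- A nonzero kernel vector would be the coordinates of a nonzero tangent vector of zero length. -/
theorem metricMatrix_det_ne_zero {c : N} {y : 𝔼} (hy : y ∈ (extChartAt (𝓡 n) c).target) :
    (metricMatrix c y).det ≠ 0 := by
  intro h
  obtain ⟨ξ, hξ, h0⟩ := Matrix.exists_mulVec_eq_zero_iff.2 h
  obtain ⟨v, hv⟩ := coordAt_surjective ((extChartAt (𝓡 n) c).map_target hy) (WithLp.toLp 2 ξ : 𝔼)
  have h1 := inner_eq_sum_metricMatrix ((extChartAt (𝓡 n) c).map_target hy) v v
  rw [(extChartAt (𝓡 n) c).right_inv hy, hv] at h1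
  have h2 : inner ℝ v v = 0 := by
    rw [h1]
    refine Finset.sum_eq_zero fun i _ ↦ ?_
    have := congrFun h0 i
    simp only [Matrix.mulVec, dotProduct, Pi.zero_apply] at this
    calc _ = ξ i * ∑ j, metricMatrix c y i j * ξ j := by
          rw [Finset.mul_sum]; exact Finset.sum_congr rfl fun j _ ↦ by simp; ring
      _ = 0 := by rw [this, mul_zero]
  rw [inner_self_eq_zero] at h2
  apply hξ
  rw [h2, map_zero] at hv
  simpa using (congrArg WithLp.ofLp hv).symm

theorem contDiffAt_metricMatrix [IsContMDiffRiemannianBundle (𝓡 n) ∞ 𝔼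
      (fun x : N ↦ TangentSpace (𝓡 n) x)]
    {c : N} {y : 𝔼} (hy : y ∈ (extChartAt (𝓡 n) c).target) (i j : Fin n) :
    ContDiffAt ℝ ∞ (fun z ↦ metricMatrix c z i j) y := by
  rw [← contMDiffAt_iff_contDiffAt]
  exact ContMDiffAt.inner_bundle (F := 𝔼) (IB := 𝓡 n) (contMDiffAt_coordField hy i)
    (contMDiffAt_coordField hy j)

/-- Testing ⟨∇u, ·⟩ = du on the coordinate vectors gives a linear system with matrix g_{ij}, which
is then inverted. -/
theorem coordAt_riemGradient {c x : N} (hx : x ∈ (extChartAt (𝓡 n) c).source) {u : N → ℝ}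
    (hu : MDifferentiableAt (𝓡 n) 𝓘(ℝ, ℝ) u x) (i : Fin n) :
    coordAt c x (riemGradient (n := n) u x) i
      = gradCoeff (metricMatrix c) (inChart c u) (extChartAt (𝓡 n) c x) i := by
  set y := extChartAt (𝓡 n) c x
  have hy : y ∈ (extChartAt (𝓡 n) c).target := (extChartAt (𝓡 n) c).map_source hx
  have hdet := metricMatrix_det_ne_zero hy
  set a : Fin n → ℝ := fun i ↦ coordAt c x (riemGradient (n := n) u x) i
  have h1 : metricMatrix c y *ᵥ a = fun j ↦ partialD j (inChart c u) y := by
    ext j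
    obtain ⟨w, hw⟩ := coordAt_surjective hx (EuclideanSpace.single j (1 : ℝ) : 𝔼)
    have h2 := inner_riemGradient u x w
    rw [inner_eq_sum_metricMatrix hx, mvfderiv_eq_fderiv_inChart hx hu, hw] at h2
    rw [partialD, ← h2]
    simp only [Matrix.mulVec, dotProduct]
    refine Finset.sum_congr rfl fun k _ ↦ ?_
    rw [Finset.sum_eq_single j]
    · rw [← (metricMatrix_isSymm c y).apply j k]
      simp [a, y]
    · intro b _ hb
      simp [hb]
    · simp
  have h3 : a = (metricMatrix c y)⁻¹ *ᵥ fun j ↦ partialD j (inChart c u) y := by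
    rw [← h1, Matrix.mulVec_mulVec, Matrix.nonsing_inv_mul _ (isUnit_iff_ne_zero.2 hdet),
      Matrix.one_mulVec]
  exact congrFun h3 i

/-- The inner product of two gradients, as a function on the manifold. -/
def innerGrad (u k : N → ℝ) (x : N) : ℝ :=
  inner ℝ (riemGradient (n := n) u x) (riemGradient (n := n) k x)

theorem innerGrad_eq_gradInner {c x : N} (hx : x ∈ (extChartAt (𝓡 n) c).source) {u k : N → ℝ}
    (hu : MDifferentiableAt (𝓡 n) 𝓘(ℝ, ℝ) u x) (hk : MDifferentiableAt (𝓡 n) 𝓘(ℝ, ℝ) k x) :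
    innerGrad (n := n) u k x
      = gradInner (metricMatrix c) (inChart c u) (inChart c k) (extChartAt (𝓡 n) c x) := by
  rw [innerGrad, inner_riemGradient, mvfderiv_eq_fderiv_inChart hx hu, fderiv_apply_eq_sum]
  simp only [coordAt_riemGradient hx hk, gradInner]
  exact Finset.sum_congr rfl fun i _ ↦ mul_comm _ _

/-- Equality on a neighbourhood, not just at the point, is what allows both sides to be
differentiated. -/
theorem inChart_innerGrad_eventuallyEq {c x : N} (hx : x ∈ (extChartAt (𝓡 n) c).source)
    {u k : N → ℝ} (hu : ContMDiffAt (𝓡 n) 𝓘(ℝ, ℝ) 2 u x) (hk : ContMDiffAt (𝓡 n) 𝓘(ℝ, ℝ) 2 k x) :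
    inChart c (innerGrad (n := n) u k) =ᶠ[𝓝 (extChartAt (𝓡 n) c x)]
      gradInner (metricMatrix c) (inChart c u) (inChart c k) := by
  have hy := (extChartAt (𝓡 n) c).map_source hx
  have hxy := (extChartAt (𝓡 n) c).left_inv hx
  have ht : Tendsto (extChartAt (𝓡 n) c).symm (𝓝 (extChartAt (𝓡 n) c x)) (𝓝 x) := by
    have := (contMDiffAt_extChartAt_symm hy).continuousAt.tendsto
    rwa [hxy] at this
  have hev : ∀ f : N → ℝ, ContMDiffAt (𝓡 n) 𝓘(ℝ, ℝ) 2 f x →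
      ∀ᶠ z in 𝓝 x, MDifferentiableAt (𝓡 n) 𝓘(ℝ, ℝ) f z := by
    intro f hf
    have : IsManifold (𝓡 n) 2 N := IsManifold.of_le (n := ∞) (WithTop.coe_le_coe.2 (le_top : (2 : ℕ∞) ≤ ⊤))
    filter_upwards [(contMDiffAt_iff_contMDiffAt_nhds (by simp)).1 hf] with z hz
    exact hz.mdifferentiableAt (by simp)
  filter_upwards [extChartAt_target_mem_nhds_of_mem hy, ht.eventually (hev u hu),
    ht.eventually (hev k hk)] with z hz h1 h2
  rw [inChart, innerGrad_eq_gradInner ((extChartAt (𝓡 n) c).map_target hz) h1 h2,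
    (extChartAt (𝓡 n) c).right_inv hz]

end Chart

/-! ### Chart independence of the Hessian. -/

section HessianChart

variable {n : ℕ} {N : Type*} [MetricSpace N] [ChartedSpace (EuclideanSpace ℝ (Fin n)) N]
  [IsManifold (𝓡 n) ∞ N] [RiemannianBundle (fun x : N ↦ TangentSpace (𝓡 n) x)]

local notation "𝔼" => EuclideanSpace ℝ (Fin n)

/-- A function linear in the chart at `x` does it. Identities tested on gradients thus hold for all
tangent vectors. -/
theorem exists_riemGradient_eq {x : N} (v : TangentSpace (𝓡 n) x) :
    ∃ h : N → ℝ, ContMDiffAt (𝓡 n) 𝓘(ℝ, ℝ) 2 h x ∧ riemGradient (n := n) h x = v := by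
  have hx := mem_extChartAt_source (I := 𝓡 n) x
  let e := LinearEquiv.ofBijective (coordAt (n := n) x x).toLinearMap
    ⟨coordAt_injective hx, coordAt_surjective hx⟩
  let ℓ : 𝔼 →L[ℝ] ℝ := LinearMap.toContinuousLinearMap ((innerₛₗ ℝ v).comp e.symm.toLinearMap)
  have hle : ∀ w, ℓ (coordAt x x w) = inner ℝ v w := by
    intro w
    have : e.symm (coordAt x x w) = w := e.symm_apply_apply w
    simp [ℓ, this]
  have hcont : ContMDiffAt (𝓡 n) 𝓘(ℝ, ℝ) 2 (fun z ↦ ℓ (extChartAt (𝓡 n) x z)) x :=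
    (ℓ.contDiff.contMDiff (n := 2)).contMDiffAt.comp x
      ((contMDiffAt_extChartAt_of_mem hx).of_le (WithTop.coe_le_coe.2 (le_top : (2 : ℕ∞) ≤ ⊤)))
  refine ⟨fun z ↦ ℓ (extChartAt (𝓡 n) x z), hcont, ext_inner_right ℝ fun w ↦ ?_⟩
  rw [inner_riemGradient, mvfderiv_eq_fderiv_inChart hx (hcont.mdifferentiableAt (by simp)), ← hle]
  have : inChart x (fun z ↦ ℓ (extChartAt (𝓡 n) x z)) =ᶠ[𝓝 (extChartAt (𝓡 n) x x)] ℓ := by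
    filter_upwards [extChartAt_target_mem_nhds_of_mem ((extChartAt (𝓡 n) x).map_source hx)] with y hy
    rw [inChart, (extChartAt (𝓡 n) x).right_inv hy]
  rw [this.fderiv_eq, ℓ.fderiv]

variable [IsContMDiffRiemannianBundle (𝓡 n) ∞ (EuclideanSpace ℝ (Fin n))
  (fun x : N ↦ TangentSpace (𝓡 n) x)]

theorem contMDiffAt_innerGrad {x : N} {u k : N → ℝ} (hu : ContMDiffAt (𝓡 n) 𝓘(ℝ, ℝ) 2 u x)
    (hk : ContMDiffAt (𝓡 n) 𝓘(ℝ, ℝ) 2 k x) :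
    ContMDiffAt (𝓡 n) 𝓘(ℝ, ℝ) 1 (innerGrad (n := n) u k) x := by
  have hx := mem_extChartAt_source (I := 𝓡 n) x
  have hy := (extChartAt (𝓡 n) x).map_source hx
  have hxy := (extChartAt (𝓡 n) x).left_inv hx
  have h2 : (2 : WithTop ℕ∞) ≤ ∞ := WithTop.coe_le_coe.2 (le_top : (2 : ℕ∞) ≤ ⊤)
  have h1 : (1 : WithTop ℕ∞) ≤ ∞ := WithTop.coe_le_coe.2 (le_top : (1 : ℕ∞) ≤ ⊤)
  have hg : ContDiffAt ℝ 1 (inChart x (innerGrad (n := n) u k)) (extChartAt (𝓡 n) x x) := by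
    refine ContDiffAt.congr_of_eventuallyEq ?_ (inChart_innerGrad_eventuallyEq hx hu hk)
    exact contDiffAt_gradInner (s := 2) (fun i j ↦ (contDiffAt_metricMatrix hy i j).of_le h1)
      (metricMatrix_det_ne_zero hy) (contDiffAt_inChart hy h2 (by rwa [hxy]))
      (contDiffAt_inChart hy h2 (by rwa [hxy])) (by norm_num)
  have heq : innerGrad (n := n) u k =ᶠ[𝓝 x]
      inChart x (innerGrad (n := n) u k) ∘ extChartAt (𝓡 n) x := by
    filter_upwards [(isOpen_extChartAt_source x).mem_nhds hx] with z hz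
    rw [Function.comp_apply, inChart, (extChartAt (𝓡 n) x).left_inv hz]
  exact (hg.contMDiffAt.comp x ((contMDiffAt_extChartAt_of_mem hx).of_le h1)).congr_of_eventuallyEq
    heq

theorem mvfderiv_innerGrad_riemGradient {c x : N} (hx : x ∈ (extChartAt (𝓡 n) c).source)
    {u h k : N → ℝ} (hu : ContMDiffAt (𝓡 n) 𝓘(ℝ, ℝ) 2 u x) (hh : ContMDiffAt (𝓡 n) 𝓘(ℝ, ℝ) 2 h x)
    (hk : ContMDiffAt (𝓡 n) 𝓘(ℝ, ℝ) 2 k x) :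
    mvfderiv (𝓡 n) (innerGrad (n := n) u k) x (riemGradient (n := n) h x) =
      ∑ m, gradCoeff (metricMatrix c) (inChart c h) (extChartAt (𝓡 n) c x) m * partialD m
        (gradInner (metricMatrix c) (inChart c u) (inChart c k)) (extChartAt (𝓡 n) c x) := by
  rw [mvfderiv_eq_fderiv_inChart hx ((contMDiffAt_innerGrad hu hk).mdifferentiableAt one_ne_zero),
    (inChart_innerGrad_eventuallyEq hx hu hk).fderiv_eq, fderiv_apply_eq_sum]
  simp only [coordAt_riemGradient hx (hh.mdifferentiableAt (by simp))]

/-- The right side does not mention the chart `c`; this is what makes the coordinate Hessian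
intrinsic. -/
theorem two_mul_sum_hessianCoeff {c x : N} (hx : x ∈ (extChartAt (𝓡 n) c).source)
    {u h k : N → ℝ} (hu : ContMDiffAt (𝓡 n) 𝓘(ℝ, ℝ) 2 u x) (hh : ContMDiffAt (𝓡 n) 𝓘(ℝ, ℝ) 2 h x)
    (hk : ContMDiffAt (𝓡 n) 𝓘(ℝ, ℝ) 2 k x) :
    2 * ∑ i, ∑ j, hessianCoeff c u i j (extChartAt (𝓡 n) c x)
        * coordAt c x (riemGradient (n := n) h x) i * coordAt c x (riemGradient (n := n) k x) j =
      mvfderiv (𝓡 n) (innerGrad (n := n) u k) x (riemGradient (n := n) h x)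
      + mvfderiv (𝓡 n) (innerGrad (n := n) u h) x (riemGradient (n := n) k x)
      - mvfderiv (𝓡 n) (innerGrad (n := n) h k) x (riemGradient (n := n) u x) := by
  have hy := (extChartAt (𝓡 n) c).map_source hx
  have hxy := (extChartAt (𝓡 n) c).left_inv hx
  have h2 : (2 : WithTop ℕ∞) ≤ ∞ := WithTop.coe_le_coe.2 (le_top : (2 : ℕ∞) ≤ ⊤)
  have h1 : (1 : WithTop ℕ∞) ≤ ∞ := WithTop.coe_le_coe.2 (le_top : (1 : ℕ∞) ≤ ⊤)
  rw [mvfderiv_innerGrad_riemGradient hx hu hh hk, mvfderiv_innerGrad_riemGradient hx hu hk hh,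
    mvfderiv_innerGrad_riemGradient hx hh hu hk,
    ← two_mul_hessian_gradCoeff (fun i j ↦ (contDiffAt_metricMatrix hy i j).of_le h1)
      (Eventually.of_forall (metricMatrix_isSymm c)) (metricMatrix_det_ne_zero hy)
      (contDiffAt_inChart hy h2 (by rwa [hxy])) (contDiffAt_inChart hy h2 (by rwa [hxy]))
      (contDiffAt_inChart hy h2 (by rwa [hxy]))]
  simp only [coordAt_riemGradient hx (hh.mdifferentiableAt (by simp)),
    coordAt_riemGradient hx (hk.mdifferentiableAt (by simp)), hessianCoeff, christoffel]

/-- The Hessian may be computed in any chart. -/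
theorem hessian_eq_sum {c x : N} (hx : x ∈ (extChartAt (𝓡 n) c).source) {u : N → ℝ}
    (hu : ContMDiffAt (𝓡 n) 𝓘(ℝ, ℝ) 2 u x) (v w : TangentSpace (𝓡 n) x) :
    hessian (n := n) u x v w = ∑ i, ∑ j, hessianCoeff c u i j (extChartAt (𝓡 n) c x)
        * coordAt c x v i * coordAt c x w j := by
  obtain ⟨h, hh, rfl⟩ := exists_riemGradient_eq v
  obtain ⟨k, hk, rfl⟩ := exists_riemGradient_eq w
  -- The charts at `c` and at `x` yield the same chart-free expression.
  have e1 := two_mul_sum_hessianCoeff hx hu hh hk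
  have e2 := two_mul_sum_hessianCoeff (mem_extChartAt_source (I := 𝓡 n) x) hu hh hk
  have e3 : hessian (n := n) u x (riemGradient (n := n) h x) (riemGradient (n := n) k x) =
    ∑ i, ∑ j, hessianCoeff x u i j (extChartAt (𝓡 n) x x)
        * coordAt x x (riemGradient (n := n) h x) i * coordAt x x (riemGradient (n := n) k x) j := rfl
  linarith

/-- The polarisation identity with all three functions equal to `u`. It turns the critical point
equation of the maximum principle into information on ∇²u. -/
theorem two_mul_hessian_riemGradient {x : N} {u : N → ℝ} (hu : ContMDiffAt (𝓡 n) 𝓘(ℝ, ℝ) 2 u x) :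
    2 * hessian (n := n) u x (riemGradient (n := n) u x) (riemGradient (n := n) u x) =
      mvfderiv (𝓡 n) (innerGrad (n := n) u u) x (riemGradient (n := n) u x) := by
  rw [hessian_eq_sum (mem_extChartAt_source (I := 𝓡 n) x) hu,
    two_mul_sum_hessianCoeff (mem_extChartAt_source (I := 𝓡 n) x) hu hu hu]
  ring

theorem hessian_symm {x : N} {u : N → ℝ} (hu : ContMDiffAt (𝓡 n) 𝓘(ℝ, ℝ) 2 u x)
    (v w : TangentSpace (𝓡 n) x) : hessian (n := n) u x v w = hessian (n := n) u x w v := by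
  obtain ⟨h, hh, rfl⟩ := exists_riemGradient_eq v
  obtain ⟨k, hk, rfl⟩ := exists_riemGradient_eq w
  have hx := mem_extChartAt_source (I := 𝓡 n) x
  have e1 := two_mul_sum_hessianCoeff hx hu hh hk
  have e2 := two_mul_sum_hessianCoeff hx hu hk hh
  rw [← hessian_eq_sum hx hu] at e1 e2
  have e3 : innerGrad (n := n) h k = innerGrad (n := n) k h := by
    ext z
    exact real_inner_comm (riemGradient (n := n) k z) (riemGradient (n := n) h z)
  rw [e3] at e1
  linarith

end HessianChart

/-! ### Continuous fields of bilinear forms and their positivity. -/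

section Forms

variable {n : ℕ} {N : Type*} [MetricSpace N] [ChartedSpace (EuclideanSpace ℝ (Fin n)) N]

local notation "𝔼" => EuclideanSpace ℝ (Fin n)

/-- A field of bilinear forms on the tangent spaces whose coefficients in the charts are
continuous. -/
def IsContinuousForm (T : ∀ x : N, TangentSpace (𝓡 n) x → TangentSpace (𝓡 n) x → ℝ) : Prop :=
  ∀ c : N, ∃ A : N → Fin n → Fin n → ℝ, (∀ i j, ContinuousAt (fun x ↦ A x i j) c) ∧
    ∀ x ∈ (extChartAt (𝓡 n) c).source, ∀ v w : TangentSpace (𝓡 n) x,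
      T x v w = ∑ i, ∑ j, A x i j * coordAt c x v i * coordAt c x w j

theorem IsContinuousForm.add {T T' : ∀ x : N, TangentSpace (𝓡 n) x → TangentSpace (𝓡 n) x → ℝ}
    (hT : IsContinuousForm T) (hT' : IsContinuousForm T') :
    IsContinuousForm fun x v w ↦ T x v w + T' x v w := by
  intro c
  obtain ⟨A, hA, h⟩ := hT c
  obtain ⟨A', hA', h'⟩ := hT' c
  refine ⟨fun x i j ↦ A x i j + A' x i j, fun i j ↦ (hA i j).add (hA' i j), fun x hx v w ↦ ?_⟩
  beta_reduce
  rw [h x hx, h' x hx, ← Finset.sum_add_distrib]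
  refine Finset.sum_congr rfl fun i _ ↦ ?_
  rw [← Finset.sum_add_distrib]
  exact Finset.sum_congr rfl fun j _ ↦ by ring

theorem IsContinuousForm.mul {T : ∀ x : N, TangentSpace (𝓡 n) x → TangentSpace (𝓡 n) x → ℝ}
    (hT : IsContinuousForm T) {f : N → ℝ} (hf : Continuous f) :
    IsContinuousForm fun x v w ↦ f x * T x v w := by
  intro c
  obtain ⟨A, hA, h⟩ := hT c
  refine ⟨fun x i j ↦ f x * A x i j, fun i j ↦ hf.continuousAt.mul (hA i j), fun x hx v w ↦ ?_⟩
  beta_reduce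
  rw [h x hx, Finset.mul_sum]
  refine Finset.sum_congr rfl fun i _ ↦ ?_
  rw [Finset.mul_sum]
  exact Finset.sum_congr rfl fun j _ ↦ by ring

/-- Compactness of the unit sphere makes positivity uniform in `ξ`; homogeneity extends it to all
nonzero vectors. -/
theorem eventually_forall_quadratic_pos {X : Type*} [TopologicalSpace X] {c : X}
    {A : X → Fin n → Fin n → ℝ} (hA : ∀ i j, ContinuousAt (fun x ↦ A x i j) c)
    (hpos : ∀ ξ : 𝔼, ξ ≠ 0 → 0 < ∑ i, ∑ j, A c i j * ξ i * ξ j) :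
    ∀ᶠ x in 𝓝 c, ∀ ξ : 𝔼, ξ ≠ 0 → 0 < ∑ i, ∑ j, A x i j * ξ i * ξ j := by
  have hcomp : IsCompact (Metric.sphere (0 : 𝔼) 1) := isCompact_sphere 0 1
  have h := hcomp.eventually_forall_of_forall_eventually (x₀ := c)
    (P := fun x ξ ↦ 0 < ∑ i, ∑ j, A x i j * ξ i * ξ j) ?_
  · filter_upwards [h] with x hx ξ hξ
    have hn : 0 < ‖ξ‖ := norm_pos_iff.2 hξ
    have h1 := hx (‖ξ‖⁻¹ • ξ) (by simp [norm_smul, hn.ne'])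
    have h2 : ∑ i, ∑ j, A x i j * (‖ξ‖⁻¹ • ξ) i * (‖ξ‖⁻¹ • ξ) j
        = ‖ξ‖⁻¹ ^ 2 * ∑ i, ∑ j, A x i j * ξ i * ξ j := by
      simp only [Finset.mul_sum, PiLp.smul_apply, smul_eq_mul]
      exact Finset.sum_congr rfl fun i _ ↦ Finset.sum_congr rfl fun j _ ↦ by ring
    rw [h2] at h1
    exact pos_of_mul_pos_right h1 (by positivity)
  · intro ξ hξ
    have hξ0 : ξ ≠ 0 := by
      rintro rfl
      simp at hξ
    have hc : ContinuousAt (fun z : X × 𝔼 ↦ ∑ i, ∑ j, A z.1 i j * z.2 i * z.2 j) (c, ξ) := by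
      refine tendsto_finsetSum _ fun i _ ↦ tendsto_finsetSum _ fun j _ ↦ ?_
      have h1 : ContinuousAt (fun z : X × 𝔼 ↦ A z.1 i j) (c, ξ) :=
        (hA i j).comp (f := fun z : X × 𝔼 ↦ z.1) (x := (c, ξ)) continuousAt_fst
      have h2 : ∀ k, ContinuousAt (fun z : X × 𝔼 ↦ z.2 k) (c, ξ) := fun k ↦
        Continuous.continuousAt (by fun_prop)
      exact (h1.mul (h2 i)).mul (h2 j)
    exact hc.eventually (lt_mem_nhds (hpos ξ hξ0))

theorem IsContinuousForm.sum_smul {T : ∀ x : N, TangentSpace (𝓡 n) x → TangentSpace (𝓡 n) x → ℝ}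
    (hT : IsContinuousForm T) (x : N) {ι : Type*} [Fintype ι] (b : ι → TangentSpace (𝓡 n) x)
    (ξ η : ι → ℝ) :
    T x (∑ i, ξ i • b i) (∑ j, η j • b j) = ∑ i, ∑ j, ξ i * (η j * T x (b i) (b j)) := by
  obtain ⟨A, -, h⟩ := hT x
  have hx := mem_extChartAt_source (I := 𝓡 n) x
  let B : TangentSpace (𝓡 n) x →ₗ[ℝ] TangentSpace (𝓡 n) x →ₗ[ℝ] ℝ :=
    LinearMap.mk₂ ℝ (T x)
      (fun v v' w ↦ by
        simp only [h x hx, map_add, PiLp.add_apply, mul_add, add_mul, Finset.sum_add_distrib])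
      (fun a v w ↦ by
        simp only [h x hx, map_smul, PiLp.smul_apply, smul_eq_mul, Finset.mul_sum]
        exact Finset.sum_congr rfl fun _ _ ↦ Finset.sum_congr rfl fun _ _ ↦ by ring)
      (fun v v' w ↦ by
        simp only [h x hx, map_add, PiLp.add_apply, mul_add, Finset.sum_add_distrib])
      (fun a v w ↦ by
        simp only [h x hx, map_smul, PiLp.smul_apply, smul_eq_mul, Finset.mul_sum]
        exact Finset.sum_congr rfl fun _ _ ↦ Finset.sum_congr rfl fun _ _ ↦ by ring)
  change B _ _ = ∑ i, ∑ j, ξ i * (η j * B (b i) (b j))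
  simp only [map_sum, LinearMap.sum_apply, map_smul, LinearMap.smul_apply, smul_eq_mul]
  rw [Finset.sum_comm]
  simp only [Finset.mul_sum]
  exact Finset.sum_congr rfl fun _ _ ↦ Finset.sum_congr rfl fun _ _ ↦ by ring

/-- In an orthonormal basis this says that an invertible positive semidefinite matrix is positive
definite. -/
theorem IsContinuousForm.pos_of_metricDet_ne_zero
    [RiemannianBundle (fun x : N ↦ TangentSpace (𝓡 n) x)]
    {T : ∀ x : N, TangentSpace (𝓡 n) x → TangentSpace (𝓡 n) x → ℝ}
    (hT : IsContinuousForm T) {x : N} (hsymm : ∀ v w, T x v w = T x w v)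
    (hnonneg : ∀ v, 0 ≤ T x v v) (hdet : metricDet x (T x) ≠ 0) {v : TangentSpace (𝓡 n) x}
    (hv : v ≠ 0) : 0 < T x v v := by
  have : FiniteDimensional ℝ (TangentSpace (𝓡 n) x) := inferInstanceAs (FiniteDimensional ℝ 𝔼)
  set b := stdOrthonormalBasis ℝ (TangentSpace (𝓡 n) x)
  set M := Matrix.of fun i j ↦ T x (b i) (b j)
  have hM : M.det ≠ 0 := hdet
  have hquad : ∀ ξ, star ξ ⬝ᵥ (M *ᵥ ξ) = T x (∑ i, ξ i • b i) (∑ i, ξ i • b i) := by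
    intro ξ
    rw [hT.sum_smul]
    simp only [dotProduct, Matrix.mulVec, Finset.mul_sum, M, Matrix.of_apply, star_trivial]
    exact Finset.sum_congr rfl fun _ _ ↦ Finset.sum_congr rfl fun _ _ ↦ by ring
  have hpsd : M.PosSemidef := by
    refine Matrix.PosSemidef.of_dotProduct_mulVec_nonneg ?_ fun ξ ↦ ?_
    · ext i j
      simp [M, hsymm (b j) (b i)]
    · rw [hquad]
      exact hnonneg _
  have hpd : M.PosDef := hpsd.posDef_iff_isUnit.2 ((Matrix.isUnit_iff_isUnit_det M).2
    (isUnit_iff_ne_zero.2 hM))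
  have hsum : ∑ i, b.repr v i • b i = v := b.sum_repr v
  have hξ : (fun i ↦ b.repr v i) ≠ 0 := by
    intro h0
    apply hv
    rw [← hsum]
    exact Finset.sum_eq_zero fun i _ ↦ by rw [show b.repr v i = 0 from congrFun h0 i, zero_smul]
  have := hpd.dotProduct_mulVec_pos hξ
  rwa [hquad, hsum] at this

variable [IsManifold (𝓡 n) ∞ N]

theorem IsContinuousForm.exists_eventually_lt
    {T T' : ∀ x : N, TangentSpace (𝓡 n) x → TangentSpace (𝓡 n) x → ℝ}
    (hT : IsContinuousForm T) (hT' : IsContinuousForm T') {c : N}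
    (hpos : ∀ v : TangentSpace (𝓡 n) c, v ≠ 0 → 0 < T c v v) :
    ∃ ε > 0, ∀ᶠ x in 𝓝 c, ∀ v : TangentSpace (𝓡 n) x, v ≠ 0 → ε * T' x v v < T x v v := by
  obtain ⟨A, hA, h⟩ := hT c
  obtain ⟨A', hA', h'⟩ := hT' c
  have hc := mem_extChartAt_source (I := 𝓡 n) c
  -- `ε` is treated as a further parameter: T - εT' is positive at (0, c), hence near it, and a
  -- small positive `ε` can be chosen.
  have hev := eventually_forall_quadratic_pos (X := ℝ × N) (c := (0, c))
    (A := fun z i j ↦ A z.2 i j - z.1 * A' z.2 i j) ?_ ?_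
  · rw [nhds_prod_eq] at hev
    obtain ⟨ε, h1, hε⟩ := ((hev.curry.filter_mono nhdsWithin_le_nhds).and
      (self_mem_nhdsWithin (s := Set.Ioi (0 : ℝ)))).exists
    refine ⟨ε, hε, ?_⟩
    filter_upwards [h1, (isOpen_extChartAt_source c).mem_nhds hc] with x hx hxs v hv
    have h2 := hx (coordAt c x v) fun h0 ↦ hv (coordAt_injective hxs (by rw [h0, map_zero]))
    rw [h x hxs, h' x hxs, ← sub_pos]
    convert h2 using 1
    simp only [Finset.mul_sum, ← Finset.sum_sub_distrib]
    exact Finset.sum_congr rfl fun i _ ↦ Finset.sum_congr rfl fun j _ ↦ by ring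
  · intro i j
    have h1 : ContinuousAt (fun z : ℝ × N ↦ A z.2 i j) (0, c) :=
      (hA i j).comp (f := fun z : ℝ × N ↦ z.2) (x := (0, c)) continuousAt_snd
    have h2 : ContinuousAt (fun z : ℝ × N ↦ A' z.2 i j) (0, c) :=
      (hA' i j).comp (f := fun z : ℝ × N ↦ z.2) (x := (0, c)) continuousAt_snd
    exact h1.sub (continuousAt_fst.mul h2)
  · intro ξ hξ
    obtain ⟨v, rfl⟩ := coordAt_surjective hc ξ
    have hv : v ≠ 0 := by
      rintro rfl
      simp at hξ
    simpa [h c hc] using hpos v hv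

/-- The local constants are combined over a finite cover; nonnegativity of `T'` lets the smaller of
two constants serve for both. -/
theorem IsContinuousForm.exists_forall_lt [CompactSpace N]
    {T T' : ∀ x : N, TangentSpace (𝓡 n) x → TangentSpace (𝓡 n) x → ℝ}
    (hT : IsContinuousForm T) (hT' : IsContinuousForm T')
    (hpos : ∀ (x : N) (v : TangentSpace (𝓡 n) x), v ≠ 0 → 0 < T x v v)
    (hnonneg : ∀ (x : N) (v : TangentSpace (𝓡 n) x), 0 ≤ T' x v v) :
    ∃ ε > 0, ∀ (x : N) (v : TangentSpace (𝓡 n) x), v ≠ 0 → ε * T' x v v < T x v v := by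
  have := isCompact_univ.induction_on (X := N)
    (p := fun s ↦ ∃ ε > 0, ∀ x ∈ s, ∀ v : TangentSpace (𝓡 n) x, v ≠ 0 → ε * T' x v v < T x v v)
    ⟨1, one_pos, by simp⟩ (fun s t hst ⟨ε, hε, h⟩ ↦ ⟨ε, hε, fun x hx ↦ h x (hst hx)⟩) ?_ ?_
  · obtain ⟨ε, hε, h⟩ := this
    exact ⟨ε, hε, fun x ↦ h x (Set.mem_univ x)⟩
  · rintro s t ⟨ε, hε, h⟩ ⟨ε', hε', h'⟩
    refine ⟨min ε ε', lt_min hε hε', ?_⟩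
    rintro x (hx | hx) v hv
    · exact (mul_le_mul_of_nonneg_right (min_le_left _ _) (hnonneg x v)).trans_lt (h x hx v hv)
    · exact (mul_le_mul_of_nonneg_right (min_le_right _ _) (hnonneg x v)).trans_lt (h' x hx v hv)
  · intro x _
    obtain ⟨ε, hε, h⟩ := hT.exists_eventually_lt hT' (hpos x)
    exact ⟨_, mem_nhdsWithin_of_mem_nhds h, ε, hε, fun z hz ↦ hz⟩

/-- A vector at `c` with negative value, carried to nearby points with the same chart coordinates,
would keep a negative value. -/
theorem IsContinuousForm.nonneg_of_frequently
    {T : ∀ x : N, TangentSpace (𝓡 n) x → TangentSpace (𝓡 n) x → ℝ}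
    (hT : IsContinuousForm T) {c : N}
    (hfreq : ∃ᶠ x in 𝓝 c, ∀ v : TangentSpace (𝓡 n) x, 0 ≤ T x v v) (v : TangentSpace (𝓡 n) c) :
    0 ≤ T c v v := by
  obtain ⟨A, hA, h⟩ := hT c
  have hc := mem_extChartAt_source (I := 𝓡 n) c
  by_contra! hlt
  rw [h c hc] at hlt
  have hcont : ContinuousAt (fun x ↦ ∑ i, ∑ j, A x i j * coordAt c c v i * coordAt c c v j) c :=
    tendsto_finsetSum _ fun i _ ↦ tendsto_finsetSum _ fun j _ ↦
      ((hA i j).mul continuousAt_const).mul continuousAt_const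
  obtain ⟨x, hx, hx1, hx2⟩ := (hfreq.and_eventually
    ((hcont.eventually (gt_mem_nhds hlt)).and ((isOpen_extChartAt_source c).mem_nhds hc))).exists
  obtain ⟨w, hw⟩ := coordAt_surjective hx2 (coordAt c c v)
  have := hx w
  rw [h x hx2, hw] at this
  linarith

end Forms

/-! ### The second derivative test at a local minimum. -/

section SecondDerivative

variable {n : ℕ}

local notation "𝔼" => EuclideanSpace ℝ (Fin n)

/-- A negative second derivative would make `t` a local maximum too, so `g` would be locally
constant. -/
theorem deriv_deriv_nonneg_of_isLocalMin {g : ℝ → ℝ} {t : ℝ} (hg : IsLocalMin g t)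
    (hc : ContinuousAt g t) : 0 ≤ deriv (deriv g) t := by
  by_contra! hlt
  have hmax := isLocalMax_of_deriv_deriv_neg hlt hg.deriv_eq_zero hc
  have heq : g =ᶠ[𝓝 t] fun _ ↦ g t := by
    filter_upwards [hg, hmax] with s h1 h2
    exact le_antisymm h2 h1
  rw [heq.deriv.deriv_eq] at hlt
  simp at hlt

theorem sum_partialD_partialD_nonneg {f : 𝔼 → ℝ} {y : 𝔼} (hf : ContDiffAt ℝ 2 f y)
    (hmin : IsLocalMin f y) (ξ : 𝔼) :
    0 ≤ ∑ i, ∑ j, partialD i (partialD j f) y * ξ i * ξ j := by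
  have hline : ∀ t : ℝ, HasDerivAt (fun t : ℝ ↦ y + t • ξ) ξ t := fun t ↦ by
    simpa using ((hasDerivAt_id t).smul_const ξ).const_add y
  have ht : Tendsto (fun t : ℝ ↦ y + t • ξ) (𝓝 0) (𝓝 y) := by
    simpa using (hline 0).continuousAt.tendsto
  have hmin' : IsLocalMin (fun t : ℝ ↦ f (y + t • ξ)) 0 := by
    have := ht.eventually hmin
    filter_upwards [this] with t ht
    simpa using ht
  have hd1 : deriv (fun t : ℝ ↦ f (y + t • ξ)) =ᶠ[𝓝 0] fun t ↦ fderiv ℝ f (y + t • ξ) ξ := by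
    filter_upwards [ht.eventually (hf.eventually (by simp))] with t h
    exact (((h.differentiableAt (by simp)).hasFDerivAt).comp_hasDerivAt t (hline t)).deriv
  have hF : DifferentiableAt ℝ (fun z ↦ fderiv ℝ f z ξ) y :=
    ((hf.fderiv_right (m := 1) (by norm_num)).differentiableAt one_ne_zero).clm_apply
      (differentiableAt_const _)
  have hd2 : deriv (deriv fun t : ℝ ↦ f (y + t • ξ)) 0
      = fderiv ℝ (fun z ↦ fderiv ℝ f z ξ) y ξ := by
    rw [hd1.deriv_eq]
    have hF' : HasFDerivAt (fun z ↦ fderiv ℝ f z ξ) (fderiv ℝ (fun z ↦ fderiv ℝ f z ξ) y)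
      (y + (0 : ℝ) • ξ) := by simpa using hF.hasFDerivAt
    exact (hF'.comp_hasDerivAt (0 : ℝ) (hline 0)).deriv
  have h := deriv_deriv_nonneg_of_isLocalMin hmin' (by
    have : ContinuousAt f (y + (0 : ℝ) • ξ) := by simpa using hf.continuousAt
    exact ContinuousAt.comp (f := fun t : ℝ ↦ y + t • ξ) this (hline 0).continuousAt)
  rw [hd2, fderiv_apply_eq_sum] at h
  convert h using 2 with i _
  have h1 : (fun z ↦ fderiv ℝ f z ξ) = fun z ↦ ∑ j, ξ j * partialD j f z := by
    ext z
    exact fderiv_apply_eq_sum f z ξ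
  have h2 : ∀ j, DifferentiableAt ℝ (partialD j f) y := fun j ↦
    (contDiffAt_partialD j hf (r := 1) (by norm_num)).differentiableAt one_ne_zero
  rw [h1, partialD_sum _ _ fun j _ ↦ (h2 j).const_mul (ξ j), Finset.mul_sum]
  refine Finset.sum_congr rfl fun j _ ↦ ?_
  rw [partialD_mul i (differentiableAt_const _) (h2 j)]
  simp [partialD]
  ring

end SecondDerivative

/-! ### Continuity and positive definiteness of the modified Hessian. -/

section ModifiedHessian

variable {n : ℕ} {N : Type*} [MetricSpace N] [ChartedSpace (EuclideanSpace ℝ (Fin n)) N]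

local notation "𝔼" => EuclideanSpace ℝ (Fin n)

theorem continuousAt_comp_extChartAt {c : N} {f : 𝔼 → ℝ}
    (hf : ContinuousAt f (extChartAt (𝓡 n) c c)) :
    ContinuousAt (fun x ↦ f (extChartAt (𝓡 n) c x)) c :=
  ContinuousAt.comp (g := f) hf (continuousAt_extChartAt c)

theorem innerGrad_self [RiemannianBundle (fun x : N ↦ TangentSpace (𝓡 n) x)] (u : N → ℝ) (x : N) :
    innerGrad (n := n) u u x = ‖riemGradient (n := n) u x‖ ^ 2 := real_inner_self_eq_norm_sq _

variable [IsManifold (𝓡 n) ∞ N]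

theorem isLocalExtr_inChart {u : N → ℝ} {x : N} (h : IsLocalExtr u x) :
    IsLocalExtr (inChart x u) (extChartAt (𝓡 n) x x) := by
  have ht := (contMDiffAt_extChartAt_symm (mem_extChartAt_target (I := 𝓡 n) x)).continuousAt.tendsto
  rw [extChartAt_to_inv] at ht
  refine h.elim (fun h ↦ Or.inl ?_) fun h ↦ Or.inr ?_
  all_goals
    filter_upwards [ht.eventually h] with z hz
    simpa only [inChart, extChartAt_to_inv] using hz

theorem isContinuousForm_mvfderiv_mul {u : N → ℝ} (hu : ContMDiff (𝓡 n) 𝓘(ℝ, ℝ) 2 u) :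
    IsContinuousForm (n := n) fun (x : N) (v w : TangentSpace (𝓡 n) x) ↦
      mvfderiv (𝓡 n) u x v * mvfderiv (𝓡 n) u x w := by
  intro c
  have h2 : (2 : WithTop ℕ∞) ≤ ∞ := WithTop.coe_le_coe.2 (le_top : (2 : ℕ∞) ≤ ⊤)
  have hp : ∀ k, ContinuousAt
      (fun x ↦ partialD k (inChart c u) (extChartAt (𝓡 n) c x)) c := fun k ↦
    continuousAt_comp_extChartAt (contDiffAt_partialD (r := 1) k
      (contDiffAt_inChart (mem_extChartAt_target c) h2 (hu _)) (by norm_num)).continuousAt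
  refine ⟨fun x i j ↦ partialD i (inChart c u) (extChartAt (𝓡 n) c x)
    * partialD j (inChart c u) (extChartAt (𝓡 n) c x), fun i j ↦ (hp i).mul (hp j),
    fun x hx v w ↦ ?_⟩
  have hd := (hu x).mdifferentiableAt (by simp)
  beta_reduce
  rw [mvfderiv_eq_fderiv_inChart hx hd, mvfderiv_eq_fderiv_inChart hx hd, fderiv_apply_eq_sum,
    fderiv_apply_eq_sum, Finset.sum_mul_sum]
  exact Finset.sum_congr rfl fun i _ ↦ Finset.sum_congr rfl fun j _ ↦ by ring

theorem isContinuousForm_of_continuous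
    {S : ∀ x : N, TangentSpace (𝓡 n) x →L[ℝ] TangentSpace (𝓡 n) x →L[ℝ] ℝ}
    (hS : Continuous (fun x : N ↦
      TotalSpace.mk' (EuclideanSpace ℝ (Fin n) →L[ℝ] EuclideanSpace ℝ (Fin n) →L[ℝ] ℝ)
        (E := fun x : N ↦ TangentSpace (𝓡 n) x →L[ℝ] TangentSpace (𝓡 n) x →L[ℝ] ℝ) x (S x))) :
    IsContinuousForm (n := n) fun (x : N) (v w : TangentSpace (𝓡 n) x) ↦ S x v w := by
  intro c
  have hcont : ∀ i j, ContinuousAt (fun y ↦ S ((extChartAt (𝓡 n) c).symm y) (coordField c i y)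
      (coordField c j y)) (extChartAt (𝓡 n) c c) := by
    intro i j
    have hy := mem_extChartAt_target (I := 𝓡 n) c
    have h := ContinuousAt.clm_bundle_apply₂ (F₁ := 𝔼) (F₂ := 𝔼) (F₃ := ℝ)
      (E₁ := fun x : N ↦ TangentSpace (𝓡 n) x) (E₂ := fun x : N ↦ TangentSpace (𝓡 n) x)
      (E₃ := Bundle.Trivial N ℝ)
      (b := (extChartAt (𝓡 n) c).symm) (ψ := fun y ↦ S ((extChartAt (𝓡 n) c).symm y))
      (v := coordField c i) (w := coordField c j) (x := extChartAt (𝓡 n) c c)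
      (ContinuousAt.comp (f := (extChartAt (𝓡 n) c).symm) hS.continuousAt
        (contMDiffAt_extChartAt_symm hy).continuousAt)
      (contMDiffAt_coordField hy i).continuousAt (contMDiffAt_coordField hy j).continuousAt
    simp only [FiberBundle.continuousAt_totalSpace] at h
    exact h.2
  refine ⟨fun x i j ↦ S ((extChartAt (𝓡 n) c).symm (extChartAt (𝓡 n) c x))
    (coordField c i (extChartAt (𝓡 n) c x)) (coordField c j (extChartAt (𝓡 n) c x)),
    fun i j ↦ continuousAt_comp_extChartAt (hcont i j), fun x hx v w ↦ ?_⟩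
  obtain ⟨y, hy, rfl⟩ : ∃ y ∈ (extChartAt (𝓡 n) c).target, (extChartAt (𝓡 n) c).symm y = x :=
    ⟨_, (extChartAt (𝓡 n) c).map_source hx, (extChartAt (𝓡 n) c).left_inv hx⟩
  beta_reduce
  rw [(extChartAt (𝓡 n) c).right_inv hy]
  conv_lhs => rw [eq_sum_coordField hy v, eq_sum_coordField hy w]
  simp only [map_sum, map_smul, sum_apply, smul_apply,
    smul_eq_mul]
  rw [Finset.sum_comm]
  simp only [Finset.mul_sum]
  exact Finset.sum_congr rfl fun _ _ ↦ Finset.sum_congr rfl fun _ _ ↦ by ring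

theorem mvfderiv_eq_zero_of_isLocalExtr {u : N → ℝ} {x : N} (h : IsLocalExtr u x)
    (hu : MDifferentiableAt (𝓡 n) 𝓘(ℝ, ℝ) u x) : mvfderiv (𝓡 n) u x = 0 := by
  ext v
  rw [mvfderiv_eq_fderiv_inChart (mem_extChartAt_source x) hu,
    (isLocalExtr_inChart h).fderiv_eq_zero]
  rfl

variable [RiemannianBundle (fun x : N ↦ TangentSpace (𝓡 n) x)]

theorem riemGradient_eq_zero_of_isLocalExtr {u : N → ℝ} {x : N} (h : IsLocalExtr u x)
    (hu : MDifferentiableAt (𝓡 n) 𝓘(ℝ, ℝ) u x) : riemGradient (n := n) u x = 0 := by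
  refine ext_inner_right ℝ fun w ↦ ?_
  rw [inner_riemGradient, mvfderiv_eq_zero_of_isLocalExtr h hu]
  simp

/-- The Christoffel terms multiply first derivatives, which vanish at the minimum, so the Euclidean
test applies. -/
theorem hessian_nonneg_of_isLocalMin {u : N → ℝ} {x : N} (h : IsLocalMin u x)
    (hu : ContMDiffAt (𝓡 n) 𝓘(ℝ, ℝ) 2 u x) (v : TangentSpace (𝓡 n) x) :
    0 ≤ hessian (n := n) u x v v := by
  have hy := mem_extChartAt_target (I := 𝓡 n) x
  have hmin : IsLocalMin (inChart x u) (extChartAt (𝓡 n) x x) := by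
    have ht := (contMDiffAt_extChartAt_symm hy).continuousAt.tendsto
    rw [extChartAt_to_inv] at ht
    filter_upwards [ht.eventually h] with z hz
    simpa only [inChart, extChartAt_to_inv] using hz
  have h0 : ∀ l, partialD l (inChart x u) (extChartAt (𝓡 n) x x) = 0 := fun l ↦ by
    rw [partialD, hmin.fderiv_eq_zero]
    rfl
  have hc : ContDiffAt ℝ 2 (inChart x u) (extChartAt (𝓡 n) x x) :=
    contDiffAt_inChart hy (WithTop.coe_le_coe.2 (le_top : (2 : ℕ∞) ≤ ⊤))
      (by rwa [extChartAt_to_inv])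
  have h1 := sum_partialD_partialD_nonneg hc hmin (vecCoord x v)
  simpa only [hessian, hessianCoeff, h0, mul_zero, Finset.sum_const_zero, sub_zero] using h1

variable [IsContMDiffRiemannianBundle (𝓡 n) ∞ (EuclideanSpace ℝ (Fin n))
  (fun x : N ↦ TangentSpace (𝓡 n) x)]

theorem isContinuousForm_inner :
    IsContinuousForm (n := n) fun (x : N) (v w : TangentSpace (𝓡 n) x) ↦ inner ℝ v w := fun c ↦
  ⟨fun x ↦ metricMatrix c (extChartAt (𝓡 n) c x), fun i j ↦
    continuousAt_comp_extChartAt (f := fun y ↦ metricMatrix c y i j)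
      (contDiffAt_metricMatrix (mem_extChartAt_target c) i j).continuousAt,
    fun _ hx ↦ inner_eq_sum_metricMatrix hx⟩

theorem continuousAt_hessianCoeff {c : N} {y : 𝔼} (hy : y ∈ (extChartAt (𝓡 n) c).target) {u : N → ℝ}
    (hu : ContMDiff (𝓡 n) 𝓘(ℝ, ℝ) 2 u) (i j : Fin n) :
    ContinuousAt (hessianCoeff c u i j) y := by
  have h2 : (2 : WithTop ℕ∞) ≤ ∞ := WithTop.coe_le_coe.2 (le_top : (2 : ℕ∞) ≤ ⊤)
  have h1 : (1 : WithTop ℕ∞) ≤ ∞ := WithTop.coe_le_coe.2 (le_top : (1 : ℕ∞) ≤ ⊤)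
  have huc : ContDiffAt ℝ 2 (inChart c u) y := contDiffAt_inChart hy h2 (hu _)
  have hG : ∀ i j, ContDiffAt ℝ 1 (fun z ↦ metricMatrix c z i j) y := fun i j ↦
    (contDiffAt_metricMatrix hy i j).of_le h1
  have hp : ∀ k, ContDiffAt ℝ 1 (partialD k (inChart c u)) y := fun k ↦
    contDiffAt_partialD k huc (by norm_num)
  have hpG : ∀ k i j, ContinuousAt (partialD k fun z ↦ metricMatrix c z i j) y := fun k i j ↦
    (contDiffAt_partialD (r := 0) k (hG i j) (by norm_num)).continuousAt
  have hinv : ∀ l m, ContinuousAt (fun z ↦ (metricMatrix c z)⁻¹ l m) y := fun l m ↦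
    (contDiffAt_inv_apply hG (metricMatrix_det_ne_zero hy) l m).continuousAt
  refine ContinuousAt.sub (contDiffAt_partialD (r := 0) i (hp j) (by norm_num)).continuousAt ?_
  refine tendsto_finsetSum _ fun l _ ↦ ContinuousAt.mul ?_ (hp l).continuousAt
  refine ContinuousAt.mul continuousAt_const (tendsto_finsetSum _ fun m _ ↦ ?_)
  exact (hinv l m).mul (((hpG i j m).add (hpG j i m)).sub (hpG m i j))

theorem isContinuousForm_hessian {u : N → ℝ} (hu : ContMDiff (𝓡 n) 𝓘(ℝ, ℝ) 2 u) :
    IsContinuousForm (n := n) (hessian (n := n) u) := fun c ↦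
  ⟨fun x i j ↦ hessianCoeff c u i j (extChartAt (𝓡 n) c x), fun i j ↦
    continuousAt_comp_extChartAt (continuousAt_hessianCoeff (mem_extChartAt_target c) hu i j),
    fun _ hx ↦ hessian_eq_sum hx (hu _)⟩

theorem continuous_innerGrad {u : N → ℝ} (hu : ContMDiff (𝓡 n) 𝓘(ℝ, ℝ) 2 u) :
    Continuous (innerGrad (n := n) u u) :=
  continuous_iff_continuousAt.2 fun x ↦ (contMDiffAt_innerGrad (hu x) (hu x)).continuousAt

theorem isContinuousForm_modifiedHessian
    {S : ∀ x : N, TangentSpace (𝓡 n) x →L[ℝ] TangentSpace (𝓡 n) x →L[ℝ] ℝ}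
    (hS : IsContinuousForm (n := n) fun (x : N) (v w : TangentSpace (𝓡 n) x) ↦ S x v w)
    {u : N → ℝ} (hu : ContMDiff (𝓡 n) 𝓘(ℝ, ℝ) 2 u) :
    IsContinuousForm (n := n) (modifiedHessian S u) := by
  have h := (((isContinuousForm_hessian hu).add (isContinuousForm_mvfderiv_mul hu)).add
    ((isContinuousForm_inner (n := n) (N := N)).mul
      (((continuous_innerGrad hu).div_const 2).neg))).add hS
  convert h using 4 with x v w
  rw [modifiedHessian, Pi.neg_apply, innerGrad_self]
  ring

theorem modifiedHessian_symm
    {S : ∀ x : N, TangentSpace (𝓡 n) x →L[ℝ] TangentSpace (𝓡 n) x →L[ℝ] ℝ}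
    (hS : ∀ (x : N) (v w : TangentSpace (𝓡 n) x), S x v w = S x w v)
    {u : N → ℝ} (hu : ContMDiff (𝓡 n) 𝓘(ℝ, ℝ) 2 u) (x : N) (v w : TangentSpace (𝓡 n) x) :
    modifiedHessian S u x v w = modifiedHessian S u x w v := by
  simp only [modifiedHessian, hS x v w, hessian_symm (hu x) v w, real_inner_comm v w]
  ring

/-- Continuity method: the set of points of positivity is open; it is closed because a limit is
semidefinite with nonzero determinant; and it contains a minimum point of `u`, where du = 0 and the
form is ∇²u + S. -/
theorem modifiedHessian_pos (hn : 1 ≤ n) [CompactSpace N] [ConnectedSpace N]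
    {S : ∀ x : N, TangentSpace (𝓡 n) x →L[ℝ] TangentSpace (𝓡 n) x →L[ℝ] ℝ}
    (hS : IsContinuousForm (n := n) fun (x : N) (v w : TangentSpace (𝓡 n) x) ↦ S x v w)
    (hS_symm : ∀ (x : N) (v w : TangentSpace (𝓡 n) x), S x v w = S x w v)
    (hS_pos : ∀ (x : N) (v : TangentSpace (𝓡 n) x), v ≠ 0 → 0 < S x v v)
    {u : N → ℝ} (hu : ContMDiff (𝓡 n) 𝓘(ℝ, ℝ) 2 u) (hsol : SolvesDetEquation S u)
    (x : N) (v : TangentSpace (𝓡 n) x) (hv : v ≠ 0) : 0 < modifiedHessian S u x v v := by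
  have hW := isContinuousForm_modifiedHessian hS hu
  set U : Set N := {x | ∀ v : TangentSpace (𝓡 n) x, v ≠ 0 → 0 < modifiedHessian S u x v v}
  have hdet : ∀ x, metricDet x (modifiedHessian S u x) ≠ 0 := by
    intro x h0
    have h1 := (hsol x).2
    -- Needed because `Real.rpow` gives 0 ^ 0 = 1; with a nonzero exponent, det = 0 would force an
    -- exponential to vanish.
    have hn' : (1 / (n : ℝ)) ≠ 0 := by positivity
    rw [h0, Real.zero_rpow hn'] at h1
    exact (Real.exp_pos _).ne h1
  have hopen : IsOpen U := by
    rw [isOpen_iff_eventually]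
    intro c hc
    obtain ⟨ε, hε, h⟩ := hW.exists_eventually_lt isContinuousForm_inner hc
    filter_upwards [h] with z hz w hw
    exact (mul_nonneg hε.le real_inner_self_nonneg).trans_lt (hz w hw)
  have hclosed : IsClosed U := by
    rw [isClosed_iff_frequently]
    intro c hc
    have hnn : ∀ v, 0 ≤ modifiedHessian S u c v v := hW.nonneg_of_frequently (hc.mono fun z hz w ↦ by
      rcases eq_or_ne w 0 with rfl | hw
      -- The empty linear combination shows that the form vanishes on the zero vector.
      · have := hW.sum_smul z (ι := Fin 0) (fun _ ↦ 0) (fun _ ↦ 0) (fun _ ↦ 0)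
        simp at this
        exact this.ge
      · exact (hz w hw).le)
    exact fun v hv ↦ hW.pos_of_metricDet_ne_zero (modifiedHessian_symm hS_symm hu c) hnn (hdet c) hv
  have hne : U.Nonempty := by
    obtain ⟨c, -, hc⟩ := isCompact_univ.exists_isMinOn Set.univ_nonempty hu.continuous.continuousOn
    have hloc : IsLocalMin u c := hc.isLocalMin univ_mem
    refine ⟨c, fun v hv ↦ ?_⟩
    have hd := (hu c).mdifferentiableAt (by simp)
    have h1 := hessian_nonneg_of_isLocalMin hloc (hu c) v
    have h2 := hS_pos c v hv
    simp only [modifiedHessian, mvfderiv_eq_zero_of_isLocalExtr hloc.isExtr hd,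
      riemGradient_eq_zero_of_isLocalExtr hloc.isExtr hd]
    simpa using add_pos_of_nonneg_of_pos h1 h2
  have huniv := IsClopen.eq_univ ⟨hclosed, hopen⟩ hne
  exact (huniv ▸ Set.mem_univ x : x ∈ U) v hv

end ModifiedHessian

/-! ### Lipschitz estimate, eigenvalue bound and the gradient estimate. -/

section Gradient

variable {n : ℕ} {N : Type*} [MetricSpace N] [ChartedSpace (EuclideanSpace ℝ (Fin n)) N]

local notation "𝔼" => EuclideanSpace ℝ (Fin n)

/-- The distance is an infimum of path lengths, and `F` stretches lengths by at most `k`. Paths of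
length below `r` are used for each r > dist x y, and `r` then decreases to the distance, so no
minimising geodesic is needed. -/
theorem abs_sub_le_mul_dist_of_abs_mvfderiv_le
    [RiemannianBundle (fun x : N ↦ TangentSpace (𝓡 n) x)] [IsRiemannianManifold (𝓡 n) N]
    {F : N → ℝ} (hF : ContMDiff (𝓡 n) 𝓘(ℝ, ℝ) 1 F) {k : ℝ} (hk : 0 ≤ k)
    (hle : ∀ (x : N) (v : TangentSpace (𝓡 n) x), |mvfderiv (𝓡 n) F x v| ≤ k * ‖v‖) (x y : N) :
    |F x - F y| ≤ k * dist x y := by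
  have hpath : ∀ r ∈ Set.Ioi (dist x y), |F x - F y| ≤ k * r := by
    intro r hr
    have hr0 : 0 < r := dist_nonneg.trans_lt hr
    have h1 : riemannianEDist (𝓡 n) x y < ENNReal.ofReal r := by
      rw [← IsRiemannianManifold.out (I := 𝓡 n) x y, edist_dist]
      exact (ENNReal.ofReal_lt_ofReal_iff hr0).2 hr
    obtain ⟨γ, h0, h1', hγ, hlen⟩ := exists_lt_of_riemannianEDist_lt h1
    have h2 : pathELength 𝓘(ℝ, ℝ) (F ∘ γ) 0 1
        ≤ ENNReal.ofReal k * pathELength (𝓡 n) γ 0 1 := by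
      rw [pathELength_eq_lintegral_mfderiv_Ioo, pathELength_eq_lintegral_mfderiv_Ioo,
        ← MeasureTheory.lintegral_const_mul' _ _ ENNReal.ofReal_ne_top]
      refine MeasureTheory.setLIntegral_mono' measurableSet_Ioo fun t ht ↦ ?_
      have hγt : MDifferentiableAt 𝓘(ℝ, ℝ) (𝓡 n) γ t :=
        (hγ.contMDiffAt (Icc_mem_nhds ht.1 ht.2)).mdifferentiableAt one_ne_zero
      have h3 : mfderiv 𝓘(ℝ, ℝ) 𝓘(ℝ, ℝ) (F ∘ γ) t 1
          = mvfderiv (𝓡 n) F (γ t) (mfderiv 𝓘(ℝ, ℝ) (𝓡 n) γ t 1) :=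
        mfderiv_comp_apply t ((hF _).mdifferentiableAt one_ne_zero) hγt 1
      rw [enorm_tangentSpace_vectorSpace, h3, ← ofReal_norm (mfderiv 𝓘(ℝ, ℝ) (𝓡 n) γ t 1),
        ← ENNReal.ofReal_mul hk, ← ofReal_norm]
      exact ENNReal.ofReal_le_ofReal (hle _ _)
    have h3 : edist (F x) (F y) ≤ ENNReal.ofReal k * ENNReal.ofReal r := by
      calc edist (F x) (F y) = riemannianEDist 𝓘(ℝ, ℝ) (F x) (F y) := IsRiemannianManifold.out _ _
        _ ≤ pathELength 𝓘(ℝ, ℝ) (F ∘ γ) 0 1 :=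
          riemannianEDist_le_pathELength (hF.comp_contMDiffOn hγ) (by simp [h0]) (by simp [h1'])
            zero_le_one
        _ ≤ ENNReal.ofReal k * pathELength (𝓡 n) γ 0 1 := h2
        _ ≤ ENNReal.ofReal k * ENNReal.ofReal r := by gcongr
    rwa [edist_dist, ← ENNReal.ofReal_mul hk, ENNReal.ofReal_le_ofReal_iff (by positivity),
      Real.dist_eq] at h3
  have ht : Tendsto (fun r ↦ k * r) (𝓝[>] (dist x y)) (𝓝 (k * dist x y)) :=
    (continuous_const.mul continuous_id).continuousAt.tendsto.mono_left nhdsWithin_le_nhds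
  exact ge_of_tendsto ht (eventually_of_mem self_mem_nhdsWithin hpath)

/-- Zero diameter leaves a single point, whereas a chart target is a nonempty open subset of ℝⁿ,
infinite for n ≥ 1. -/
theorem diam_univ_pos [CompactSpace N] [Nonempty N] (hn : 1 ≤ n) :
    0 < Metric.diam (Set.univ : Set N) := by
  by_contra! h
  have h0 : Metric.diam (Set.univ : Set N) = 0 := le_antisymm h Metric.diam_nonneg
  have hsub : Subsingleton N := ⟨fun x y ↦ dist_le_zero.1
    ((Metric.dist_le_diam_of_mem isCompact_univ.isBounded trivial trivial).trans h)⟩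
  obtain ⟨c⟩ := ‹Nonempty N›
  have : Nonempty (Fin n) := ⟨⟨0, hn⟩⟩
  have : Nontrivial 𝔼 := inferInstance
  have hneb : (𝓝[≠] (extChartAt (𝓡 n) c c)).NeBot := Module.punctured_nhds_neBot ℝ 𝔼 _
  have hinf := infinite_of_mem_nhds (extChartAt (𝓡 n) c c)
    ((isOpen_extChartAt_target c).mem_nhds (mem_extChartAt_target (I := 𝓡 n) c))
  refine hinf (Set.Subsingleton.finite fun y hy z hz ↦ ?_)
  rw [← (extChartAt (𝓡 n) c).right_inv hy, ← (extChartAt (𝓡 n) c).right_inv hz,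
    Subsingleton.elim ((extChartAt (𝓡 n) c).symm y) ((extChartAt (𝓡 n) c).symm z)]

variable [IsManifold (𝓡 n) ∞ N] [RiemannianBundle (fun x : N ↦ TangentSpace (𝓡 n) x)]
  [IsContMDiffRiemannianBundle (𝓡 n) ∞ (EuclideanSpace ℝ (Fin n))
    (fun x : N ↦ TangentSpace (𝓡 n) x)]

/-- On each tangent space the supremum of the Rayleigh quotient is an eigenvalue, hence at most
`lambdaMax S`, provided the set of eigenvalues is bounded above. -/
theorem form_le_lambdaMax [CompactSpace N]
    {S : ∀ x : N, TangentSpace (𝓡 n) x →L[ℝ] TangentSpace (𝓡 n) x →L[ℝ] ℝ}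
    (hS : IsContinuousForm (n := n) fun (x : N) (v w : TangentSpace (𝓡 n) x) ↦ S x v w)
    (hS_symm : ∀ (x : N) (v w : TangentSpace (𝓡 n) x), S x v w = S x w v)
    (hS_nonneg : ∀ (x : N) (v : TangentSpace (𝓡 n) x), 0 ≤ S x v v)
    (x : N) (v : TangentSpace (𝓡 n) x) : S x v v ≤ lambdaMax S * ‖v‖ ^ 2 := by
  -- The metric is the positive form here: εS < g bounds every Rayleigh quotient of `S` by 1/ε,
  -- uniformly over `N`.
  obtain ⟨ε, hε, hlt⟩ := (isContinuousForm_inner (n := n) (N := N)).exists_forall_lt hS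
    (fun x v hv ↦ real_inner_self_pos.2 hv) hS_nonneg
  have hbound : ∀ (x : N) (v : TangentSpace (𝓡 n) x), v ≠ 0 → S x v v / ‖v‖ ^ 2 ≤ ε⁻¹ := by
    intro x v hv
    have h1 := hlt x v hv
    have h2 : 0 < ‖v‖ := norm_pos_iff.2 hv
    rw [real_inner_self_eq_norm_sq] at h1
    rw [div_le_iff₀ (by positivity), inv_mul_eq_div, le_div_iff₀ hε, mul_comm]
    exact h1.le
  have hbdd : BddAbove {μ : ℝ | ∃ (x : N) (v : TangentSpace (𝓡 n) x), v ≠ 0 ∧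
      ∀ w : TangentSpace (𝓡 n) x, S x v w = μ * inner ℝ v w} := by
    refine ⟨ε⁻¹, ?_⟩
    rintro μ ⟨x, v, hv, h⟩
    have h2 : 0 < ‖v‖ := norm_pos_iff.2 hv
    have h1 := hbound x v hv
    rwa [h v, real_inner_self_eq_norm_sq, mul_div_assoc, div_self (by positivity), mul_one] at h1
  rcases eq_or_ne v 0 with rfl | hv
  · simp
  have : FiniteDimensional ℝ (TangentSpace (𝓡 n) x) := inferInstanceAs (FiniteDimensional ℝ 𝔼)
  have : CompleteSpace (TangentSpace (𝓡 n) x) := FiniteDimensional.complete ℝ _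
  have : Nontrivial (TangentSpace (𝓡 n) x) := ⟨v, 0, hv⟩
  let A : TangentSpace (𝓡 n) x →ₗ[ℝ] TangentSpace (𝓡 n) x :=
    { toFun := fun v ↦ (InnerProductSpace.toDual ℝ (TangentSpace (𝓡 n) x)).symm (S x v)
      map_add' := fun v w ↦ by simp
      map_smul' := fun a v ↦ by simp }
  have hA : ∀ v w, inner ℝ (A v) w = S x v w := fun v w ↦ InnerProductSpace.toDual_symm_apply
  have hAs : A.IsSymmetric := fun v w ↦ by
    rw [hA, real_inner_comm, hA, hS_symm]
  obtain ⟨w, hw⟩ := hAs.hasEigenvalue_iSup_of_finiteDimensional.exists_hasEigenvector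
  set μ : ℝ := ⨆ v : { v : TangentSpace (𝓡 n) x // v ≠ 0 },
    RCLike.re (inner ℝ (A v) (v : TangentSpace (𝓡 n) x)) / ‖(v : TangentSpace (𝓡 n) x)‖ ^ 2
  have hμ : S x v v / ‖v‖ ^ 2 ≤ μ := by
    have := le_ciSup (f := fun v : { v : TangentSpace (𝓡 n) x // v ≠ 0 } ↦
      RCLike.re (inner ℝ (A v) (v : TangentSpace (𝓡 n) x)) / ‖(v : TangentSpace (𝓡 n) x)‖ ^ 2)
      ⟨ε⁻¹, by
        rintro _ ⟨⟨z, hz⟩, rfl⟩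
        simpa [hA] using hbound x z hz⟩ ⟨v, hv⟩
    simpa [hA, μ] using this
  have hle : μ ≤ lambdaMax S := by
    refine le_csSup hbdd ⟨x, w, hw.2, fun z ↦ ?_⟩
    rw [← hA, hw.apply_eq_smul, real_inner_smul_left]
    rfl
  have h2 : 0 < ‖v‖ := norm_pos_iff.2 hv
  have := hμ.trans hle
  rwa [div_le_iff₀ (by positivity)] at this

/-- Maximum principle for P = e^u (q/4 + K). The weight e^u and the factor 1/4 are tuned so that, in
the direction ∇u, the q² terms of dP = 0 cancel those of the modified Hessian, leaving S(∇u, ∇u) -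
2Kq. -/
theorem innerGrad_le_of_form_lt [CompactSpace N] [Nonempty N]
    {S : ∀ x : N, TangentSpace (𝓡 n) x →L[ℝ] TangentSpace (𝓡 n) x →L[ℝ] ℝ}
    {u : N → ℝ} (hu : ContMDiff (𝓡 n) 𝓘(ℝ, ℝ) 2 u) {lam ε M : ℝ}
    (hε : ∀ (x : N) (v : TangentSpace (𝓡 n) x), v ≠ 0 → ε * ‖v‖ ^ 2 < modifiedHessian S u x v v)
    (hlam : ∀ (x : N) (v : TangentSpace (𝓡 n) x), S x v v ≤ lam * ‖v‖ ^ 2)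
    (hεlam : ε ≤ lam) (hM : ∀ x, u x ≤ M) (x : N) :
    innerGrad (n := n) u u x ≤ 2 * (lam - ε) * (Real.exp (M - u x) - 1) := by
  set K := (lam - ε) / 2 with hK
  set q := innerGrad (n := n) u u with hq
  have hqc : Continuous q := continuous_innerGrad hu
  set P : N → ℝ := fun x ↦ Real.exp (u x) * (q x / 4 + K) with hP
  have hPc : Continuous P := (Real.continuous_exp.comp hu.continuous).mul
    ((hqc.div_const 4).add continuous_const)
  obtain ⟨c, -, hc⟩ := isCompact_univ.exists_isMaxOn Set.univ_nonempty hPc.continuousOn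
  have hqzero : q c = 0 := by
    by_contra hne
    have hloc : IsLocalExtr P c := (hc.isLocalMax univ_mem).isExtr
    have hcs := mem_extChartAt_source (I := 𝓡 n) c
    have hy := mem_extChartAt_target (I := 𝓡 n) c
    have h2 : (2 : WithTop ℕ∞) ≤ ∞ := WithTop.coe_le_coe.2 (le_top : (2 : ℕ∞) ≤ ⊤)
    have h1 : (1 : WithTop ℕ∞) ≤ ∞ := WithTop.coe_le_coe.2 (le_top : (1 : ℕ∞) ≤ ⊤)
    have hqm := contMDiffAt_innerGrad (n := n) (hu c) (hu c)
    have hud : HasFDerivAt (inChart c u) _ (extChartAt (𝓡 n) c c) :=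
      ((contDiffAt_inChart hy h2 (hu _)).differentiableAt (by simp)).hasFDerivAt
    have hqd : HasFDerivAt (inChart c q) _ (extChartAt (𝓡 n) c c) :=
      ((contDiffAt_inChart hy h1 (by rwa [extChartAt_to_inv])).differentiableAt
        one_ne_zero).hasFDerivAt
    have hPd := (hud.exp.mul ((hqd.mul_const (4⁻¹ : ℝ)).add_const K)).fderiv
    have hPeq : inChart (n := n) c P =
        fun z ↦ Real.exp (inChart c u z) * (inChart c q z * 4⁻¹ + K) := by
      ext z
      simp only [inChart, hP, div_eq_mul_inv]
    have h0 := (isLocalExtr_inChart (n := n) hloc).fderiv_eq_zero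
    have h3 := congrArg (fun L ↦ L (coordAt c c (riemGradient (n := n) u c))) (hPd.symm.trans
      ((congrArg (fun f ↦ fderiv ℝ f (extChartAt (𝓡 n) c c)) hPeq).symm.trans h0))
    simp only [add_apply, smul_apply, smul_eq_mul, zero_apply] at h3
    rw [← mvfderiv_eq_fderiv_inChart hcs ((hu c).mdifferentiableAt (by simp)),
      ← mvfderiv_eq_fderiv_inChart hcs (hqm.mdifferentiableAt one_ne_zero),
      ← two_mul_hessian_riemGradient (hu c), ← inner_riemGradient] at h3
    have h4 : inChart c u (extChartAt (𝓡 n) c c) = u c := by simp only [inChart, extChartAt_to_inv]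
    have h5 : inChart c q (extChartAt (𝓡 n) c c) = q c := by simp only [inChart, extChartAt_to_inv]
    rw [h4, h5] at h3
    have hqn : q c = ‖riemGradient (n := n) u c‖ ^ 2 := innerGrad_self u c
    have hg : riemGradient (n := n) u c ≠ 0 := fun h ↦ hne (by rw [hqn, h]; simp)
    have h6 := hε c _ hg
    have h7 := hlam c (riemGradient (n := n) u c)
    simp only [modifiedHessian, ← inner_riemGradient, real_inner_self_eq_norm_sq, ← hqn] at h3 h6 h7
    have hexp := Real.exp_pos (u c)
    -- This is dP(∇u) = 0. With 2K = lam - ε, it puts the modified Hessian at (∇u, ∇u) at most ε q,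
    -- against `h6`.
    have h8 : Real.exp (u c) * (hessian (n := n) u c (riemGradient (n := n) u c)
        (riemGradient (n := n) u c) / 2
        + q c * (q c / 4 + K)) = 0 := by linarith
    have h9 := (mul_eq_zero.1 h8).resolve_left hexp.ne'
    nlinarith
  have h1 : P x ≤ P c := hc (Set.mem_univ x)
  simp only [hP, hqzero, zero_div, zero_add] at h1
  have hK0 : 0 ≤ K := by rw [hK]; linarith
  have h2 : Real.exp (u x) * (q x / 4 + K) ≤ Real.exp M * K :=
    h1.trans (mul_le_mul_of_nonneg_right (Real.exp_le_exp.2 (hM c)) hK0)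
  have h3 : q x / 4 + K ≤ Real.exp (M - u x) * K := by
    rw [Real.exp_sub, div_mul_eq_mul_div, le_div_iff₀ (Real.exp_pos _)]
    linarith
  have h4 : lam - ε = 2 * K := by rw [hK]; ring
  rw [h4]
  linarith

end Gradient

/-! ### Integrating the gradient estimate through the arccosine. -/

section Oscillation

variable {n : ℕ} {N : Type*} [MetricSpace N] [ChartedSpace (EuclideanSpace ℝ (Fin n)) N]

/-- Dividing by A > 1 keeps the argument away from 1, where arccos is not differentiable; this
happens at maximum points of `u`. -/
theorem hasDerivAt_arccos_exp {A M t : ℝ} (hA : 1 < A) (ht : t ≤ M) :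
    HasDerivAt (fun t ↦ Real.arccos (Real.exp ((t - M) / 2) / A))
      (-(1 / √(1 - (Real.exp ((t - M) / 2) / A) ^ 2)) * (Real.exp ((t - M) / 2) / A / 2)) t
      ∧ Real.exp ((t - M) / 2) / A < 1 := by
  have h1 : Real.exp ((t - M) / 2) ≤ 1 := Real.exp_le_one_iff.2 (by linarith)
  have h0 : 0 < Real.exp ((t - M) / 2) / A := by positivity
  have hlt : Real.exp ((t - M) / 2) / A < 1 := by
    rw [div_lt_one (by linarith)]
    linarith
  refine ⟨?_, hlt⟩
  have hin : HasDerivAt (fun t ↦ Real.exp ((t - M) / 2) / A) (Real.exp ((t - M) / 2) / A / 2) t := by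
    have := ((((hasDerivAt_id t).sub_const M).div_const 2).exp).div_const A
    refine this.congr_deriv ?_
    simp only [id_eq]
    ring
  have hne : Real.exp ((t - M) / 2) / A ≠ -1 := by linarith
  exact HasDerivAt.comp (h₂ := Real.arccos) t (Real.hasDerivAt_arccos hne hlt.ne) hin

variable [RiemannianBundle (fun x : N ↦ TangentSpace (𝓡 n) x)]

/-- With s = e^{(u - M)/2}/A the gradient bound reads q ≤ 4K(1/(A²s²) - 1). Hence the squared slope
s²q/(4(1 - s²)) is at most K(1/A² - s²)/(1 - s²) ≤ K. -/
theorem abs_mvfderiv_arccos_exp_le {u : N → ℝ} {x : N}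
    (hu : MDifferentiableAt (𝓡 n) 𝓘(ℝ, ℝ) u x) {K M A : ℝ} (hK : 0 ≤ K) (hA : 1 < A) (hM : u x ≤ M)
    (hgrad : innerGrad (n := n) u u x ≤ 4 * K * (Real.exp (M - u x) - 1))
    (v : TangentSpace (𝓡 n) x) :
    |mvfderiv (𝓡 n) (fun x ↦ Real.arccos (Real.exp ((u x - M) / 2) / A)) x v| ≤ √K * ‖v‖ := by
  obtain ⟨hd, hs1⟩ := hasDerivAt_arccos_exp hA hM
  set s := Real.exp ((u x - M) / 2) / A with hs
  have hs0 : 0 < s := by positivity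
  have h1 : mvfderiv (𝓡 n) (fun x ↦ Real.arccos (Real.exp ((u x - M) / 2) / A)) x v
      = (-(1 / √(1 - s ^ 2)) * (s / 2)) * mvfderiv (𝓡 n) u x v := by
    have h2 := mvfderiv_comp_apply (I := 𝓘(ℝ, ℝ)) (I' := 𝓡 n) x
      (hd.differentiableAt.mdifferentiableAt) hu v
    have h3 : ∀ w : ℝ, mvfderiv 𝓘(ℝ, ℝ) (fun t ↦ Real.arccos (Real.exp ((t - M) / 2) / A)) (u x) w
        = (-(1 / √(1 - s ^ 2)) * (s / 2)) * w := by
      intro w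
      have h4 : mvfderiv 𝓘(ℝ, ℝ) (fun t ↦ Real.arccos (Real.exp ((t - M) / 2) / A)) (u x) w
          = fderiv ℝ (fun t ↦ Real.arccos (Real.exp ((t - M) / 2) / A)) (u x) w := by
        rw [← mfderiv_eq_fderiv]
        rfl
      rw [h4, hd.hasFDerivAt.fderiv]
      simp [mul_comm]
    exact h2.trans (h3 _)
  have hpos : 0 < 1 - s ^ 2 := by nlinarith
  rw [h1, abs_mul, abs_mul, abs_neg, abs_of_pos (by positivity), abs_of_pos (by positivity),
    ← inner_riemGradient]
  have h3 : ‖riemGradient (n := n) u x‖ ≤ √(4 * K * (Real.exp (M - u x) - 1)) := by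
    apply Real.le_sqrt_of_sq_le
    rw [← innerGrad_self]
    exact hgrad
  have h4 : Real.exp (M - u x) = 1 / (A ^ 2 * s ^ 2) := by
    rw [hs, div_pow, mul_div_cancel₀ _ (by positivity), ← Real.exp_nat_mul, one_div,
      ← Real.exp_neg]
    congr 1
    push_cast
    ring
  have h5 : 1 / √(1 - s ^ 2) * (s / 2) * √(4 * K * (Real.exp (M - u x) - 1)) ≤ √K := by
    have e1 : 1 / √(1 - s ^ 2) * (s / 2) = √(s ^ 2 / (4 * (1 - s ^ 2))) := by
      rw [Real.sqrt_div (by positivity), Real.sqrt_sq hs0.le, Real.sqrt_mul (by norm_num),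
        show (4 : ℝ) = 2 ^ 2 by norm_num, Real.sqrt_sq (by norm_num)]
      field_simp
    rw [e1, ← Real.sqrt_mul (by positivity)]
    apply Real.sqrt_le_sqrt
    rw [h4]
    have e2 : s ^ 2 / (4 * (1 - s ^ 2)) * (4 * K * (1 / (A ^ 2 * s ^ 2) - 1))
        = K * ((1 / A ^ 2 - s ^ 2) / (1 - s ^ 2)) := by
      field_simp
    rw [e2]
    refine mul_le_of_le_one_right hK ((div_le_one hpos).2 ?_)
    have : 1 / A ^ 2 ≤ 1 := by
      rw [div_le_one (by positivity)]
      nlinarith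
    linarith
  calc _ ≤ 1 / √(1 - s ^ 2) * (s / 2) * (√(4 * K * (Real.exp (M - u x) - 1)) * ‖v‖) := by
        refine mul_le_mul_of_nonneg_left ?_ (by positivity)
        exact (abs_real_inner_le_norm _ _).trans (mul_le_mul_of_nonneg_right h3 (norm_nonneg v))
    _ = 1 / √(1 - s ^ 2) * (s / 2) * √(4 * K * (Real.exp (M - u x) - 1)) * ‖v‖ := by ring
    _ ≤ √K * ‖v‖ := mul_le_mul_of_nonneg_right h5 (norm_nonneg v)

theorem arccos_exp_le_mul_dist [IsRiemannianManifold (𝓡 n) N] {u : N → ℝ}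
    (hu : ContMDiff (𝓡 n) 𝓘(ℝ, ℝ) 2 u) {K : ℝ} (hK : 0 ≤ K) {y : N} (hM : ∀ x, u x ≤ u y)
    (hgrad : ∀ x, innerGrad (n := n) u u x ≤ 4 * K * (Real.exp (u y - u x) - 1)) (x : N) :
    Real.arccos (Real.exp ((u x - u y) / 2)) ≤ √K * dist x y := by
  have hA : ∀ A ∈ Set.Ioi (1 : ℝ), Real.arccos (Real.exp ((u x - u y) / 2) / A)
      - Real.arccos (1 / A) ≤ √K * dist x y := by
    intro A hA
    have hF : ContMDiff (𝓡 n) 𝓘(ℝ, ℝ) 1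
        fun x ↦ Real.arccos (Real.exp ((u x - u y) / 2) / A) := by
      intro z
      have hlt := (hasDerivAt_arccos_exp hA (hM z)).2
      have h0 : 0 < Real.exp ((u z - u y) / 2) / A :=
        div_pos (Real.exp_pos _) (one_pos.trans hA)
      have hne : Real.exp ((u z - u y) / 2) / A ≠ -1 := by linarith
      have h1 : ContDiffAt ℝ 1 (fun t ↦ Real.arccos (Real.exp ((t - u y) / 2) / A)) (u z) :=
        ContDiffAt.comp (g := Real.arccos) (u z) (Real.contDiffAt_arccos hne hlt.ne) (by fun_prop)
      exact h1.contMDiffAt.comp z ((hu z).of_le (by norm_num))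
    have h2 := abs_sub_le_mul_dist_of_abs_mvfderiv_le hF (Real.sqrt_nonneg K) (fun z v ↦
      abs_mvfderiv_arccos_exp_le ((hu z).mdifferentiableAt (by simp)) hK hA (hM z) (hgrad z) v) x y
    simpa using (le_abs_self _).trans h2
  have hc : ∀ a : ℝ, ContinuousAt (fun A : ℝ ↦ Real.arccos (a / A)) 1 := fun a ↦
    Real.continuous_arccos.continuousAt.comp (f := fun A : ℝ ↦ a / A)
      (continuousAt_const.div continuousAt_id one_ne_zero)
  -- Letting `A` decrease to 1 removes the regularisation; the term at `y` tends to arccos 1 = 0.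
  have ht := (((hc (Real.exp ((u x - u y) / 2))).sub (hc 1)).tendsto).mono_left
    (nhdsWithin_le_nhds (s := Set.Ioi (1 : ℝ)))
  simpa using le_of_tendsto ht (eventually_of_mem self_mem_nhdsWithin hA)

end Oscillation

end ConformalHessian

end

/-! ### The oscillation estimate. -/

theorem mainTheorem7 {n : ℕ} (hn : 1 ≤ n) {N : Type*} [MetricSpace N] [CompactSpace N]
    [ConnectedSpace N] [ChartedSpace (EuclideanSpace ℝ (Fin n)) N] [IsManifold (𝓡 n) ∞ N]
    [RiemannianBundle (fun x : N ↦ TangentSpace (𝓡 n) x)]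
    [IsContMDiffRiemannianBundle (𝓡 n) ∞ (EuclideanSpace ℝ (Fin n))
      (fun x : N ↦ TangentSpace (𝓡 n) x)]
    [IsRiemannianManifold (𝓡 n) N]
    (S : ∀ x : N, TangentSpace (𝓡 n) x →L[ℝ] TangentSpace (𝓡 n) x →L[ℝ] ℝ)
    (hS_cont : Continuous (fun x : N ↦
      TotalSpace.mk' (EuclideanSpace ℝ (Fin n) →L[ℝ] EuclideanSpace ℝ (Fin n) →L[ℝ] ℝ)
        (E := fun x : N ↦ TangentSpace (𝓡 n) x →L[ℝ] TangentSpace (𝓡 n) x →L[ℝ] ℝ) x (S x)))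
    (hS_symm : ∀ (x : N) (v w : TangentSpace (𝓡 n) x), S x v w = S x w v)
    (hS_pos : ∀ (x : N) (v : TangentSpace (𝓡 n) x), v ≠ 0 → 0 < S x v v)
    (u : N → ℝ) (hu : ContMDiff (𝓡 n) 𝓘(ℝ, ℝ) 2 u)
    (hsol : ConformalHessian.SolvesDetEquation S u)
    (hD : ConformalHessian.lambdaMax S * Metric.diam (Set.univ : Set N) ^ 2 < Real.pi ^ 2 / 2) :
    2 * Real.log (Real.cos (Metric.diam (Set.univ : Set N) *
        Real.sqrt (ConformalHessian.lambdaMax S / 2))) + (⨆ x, u x) < ⨅ x, u x := by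
  have hS := ConformalHessian.isContinuousForm_of_continuous hS_cont
  have hW := ConformalHessian.isContinuousForm_modifiedHessian hS hu
  have hS_nonneg : ∀ (x : N) (v : TangentSpace (𝓡 n) x), 0 ≤ S x v v := fun x v ↦ by
    rcases eq_or_ne v 0 with rfl | hv
    · simp
    · exact (hS_pos x v hv).le
  have hlam := ConformalHessian.form_le_lambdaMax hS hS_symm hS_nonneg
  have hDpos := ConformalHessian.diam_univ_pos (n := n) (N := N) hn
  set D := Metric.diam (Set.univ : Set N) with hDdef
  set lam := ConformalHessian.lambdaMax S with hlamdef
  obtain ⟨x₁, -, hx₁⟩ := isCompact_univ.exists_isMinOn Set.univ_nonempty hu.continuous.continuousOn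
  obtain ⟨x₂, -, hx₂⟩ := isCompact_univ.exists_isMaxOn Set.univ_nonempty hu.continuous.continuousOn
  have hmin : ∀ x, u x₁ ≤ u x := fun x ↦ hx₁ (Set.mem_univ x)
  have hmax : ∀ x, u x ≤ u x₂ := fun x ↦ hx₂ (Set.mem_univ x)
  have hsup : ⨆ x, u x = u x₂ := le_antisymm (ciSup_le hmax)
    (le_ciSup (f := u) ⟨u x₂, by rintro _ ⟨x, rfl⟩; exact hmax x⟩ x₂)
  have hinf : ⨅ x, u x = u x₁ := le_antisymm
    (ciInf_le (f := u) ⟨u x₁, by rintro _ ⟨x, rfl⟩; exact hmin x⟩ x₁) (le_ciInf hmin)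
  have hlampos : 0 < lam := by
    have : Nonempty (Fin n) := ⟨⟨0, hn⟩⟩
    have : Nontrivial (TangentSpace (𝓡 n) x₁) :=
      inferInstanceAs (Nontrivial (EuclideanSpace ℝ (Fin n)))
    obtain ⟨v, hv⟩ := exists_ne (0 : TangentSpace (𝓡 n) x₁)
    have h1 := (hS_pos x₁ v hv).trans_le (hlam x₁ v)
    exact pos_of_mul_pos_left h1 (by positivity)
  obtain ⟨ε₀, hε₀, hlt⟩ := hW.exists_forall_lt ConformalHessian.isContinuousForm_inner
    (ConformalHessian.modifiedHessian_pos hn hS hS_symm hS_pos hu hsol)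
    (fun x v ↦ real_inner_self_nonneg)
  -- Capping by `lam` guarantees K ≥ 0, as the gradient and arccosine estimates require.
  set ε := min ε₀ lam with hε
  have hεpos : 0 < ε := lt_min hε₀ hlampos
  have hεlam : ε ≤ lam := min_le_right _ _
  set K := (lam - ε) / 2 with hK
  have hK0 : 0 ≤ K := by rw [hK]; linarith
  have hgrad : ∀ x, ConformalHessian.innerGrad (n := n) u u x
      ≤ 4 * K * (Real.exp (u x₂ - u x) - 1) := by
    intro x
    have := ConformalHessian.innerGrad_le_of_form_lt (S := S) hu (lam := lam) (ε := ε) (M := u x₂)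
      (fun x v hv ↦ by
        refine lt_of_le_of_lt ?_ (hlt x v hv)
        rw [real_inner_self_eq_norm_sq]
        exact mul_le_mul_of_nonneg_right (min_le_left _ _) (by positivity)) hlam hεlam hmax x
    convert this using 2
    rw [hK]
    ring
  have harc := ConformalHessian.arccos_exp_le_mul_dist hu hK0 hmax hgrad x₁
  have hdist : dist x₁ x₂ ≤ D :=
    Metric.dist_le_diam_of_mem isCompact_univ.isBounded trivial trivial
  have hθ : Real.arccos (Real.exp ((u x₁ - u x₂) / 2)) < D * √(lam / 2) := by
    calc _ ≤ √K * dist x₁ x₂ := harc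
      _ ≤ √K * D := mul_le_mul_of_nonneg_left hdist (Real.sqrt_nonneg K)
      -- The only strict step: K < lam/2 because ε > 0, and D > 0.
      _ < √(lam / 2) * D := by
        refine mul_lt_mul_of_pos_right (Real.sqrt_lt_sqrt hK0 ?_) hDpos
        rw [hK]
        linarith
      _ = D * √(lam / 2) := mul_comm _ _
  -- The hypothesis on lam·D² enters only here; it keeps the cosine positive, so that the logarithm
  -- is monotone there.
  have hpi : D * √(lam / 2) < Real.pi / 2 := by
    refine lt_of_pow_lt_pow_left₀ 2 (by positivity) ?_
    rw [mul_pow, Real.sq_sqrt (by positivity)]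
    linarith
  have hcos := Real.cos_lt_cos_of_nonneg_of_le_pi (Real.arccos_nonneg _)
    (by linarith [Real.pi_pos]) hθ
  rw [Real.cos_arccos (by linarith [Real.exp_pos ((u x₁ - u x₂) / 2)])
    (Real.exp_le_one_iff.2 (by linarith [hmax x₁]))] at hcos
  have hcpos : 0 < Real.cos (D * √(lam / 2)) :=
    Real.cos_pos_of_mem_Ioo ⟨by linarith [Real.arccos_nonneg (Real.exp ((u x₁ - u x₂) / 2)),
      Real.pi_pos], hpi⟩
  have hlog := Real.log_lt_log hcpos hcos
  rw [Real.log_exp] at hlog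
  rw [hsup, hinf]
  linarith
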